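/- \textbf{Conventions.} Everything is over $\mathbb{Q}$ and homologically graded (differentials have degree $-1$). Let $C_2=\{1,-1\}$, and let $\mathbb{Q}^{\mathrm{sgn}}$ be its sign representation. For $K\in\{\mathbb{Q},\mathbb{Q}^{\mathrm{sgn}}\}$ and $r\in\mathbb{Z}$, $K[r]$ is $K$ placed in degree $r$, and $\mathcal{L}(K[r])$ is the free graded Lie algebra on $K[r]$ (the graded Lie subalgebra of the tensor algebra generated by $K[r]$ under graded commutators), with zero differential and the induced $C_2$-action. For a smooth $n$-manifold $M$ without boundary ($n\ge 0$), $\widetilde M\to M$ is the orientation double cover, with $C_2$ acting by deck transformations, and $\widetilde M^+$ is its one-point compactification, pointed at $\infty$ (a disjoint base point is added if $\widetilde M$ is compact), with the induced action. $A_{PL}(\widetilde M^+)$ is the nonunital commutative differential graded algebra of polynomial differential forms with rational coefficients on the singular simplicial set of $\widetilde M^+$ that restrict to zero on the base point, a $p$-form having degree $-p$. The tensor product $A_{PL}(\widetilde M^+)\otimes\mathcal{L}(K[r])$ is a differential graded Lie algebra with bracket $[a\otimes v,b\otimes w]=(-1)^{|v||b|}ab\otimes[v,w]$ and with the diagonal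 $C_2$-action. We write $\mathrm{Map}^{C_2}(\widetilde M^+,\mathcal{L}(K[r]))$ for the differential graded Lie algebra $$\big(A_{PL}(\widetilde M^+)\otimes\mathcal{L}(K[r])\big)^{C_2}$$ of $C_2$-fixed elements, considered up to equivalence, where two differential graded Lie algebras are equivalent if they are connected by a finite zig-zag of quasi-isomorphisms of differential graded Lie algebras. A differential graded Lie algebra $\mathfrak{g}$ is \emph{formal} if it is equivalent to its homology $H(\mathfrak{g})$, equipped with the induced bracket and zero differential. \textbf{Proposition.} Let $K$ be either $\mathbb{Q}$ or $\mathbb{Q}^{\mathrm{sgn}}$. For any $r\in\mathbb{Z}$ and any smooth manifold $M$, the differential graded Lie algebra $\mathrm{Map}^{C_2}(\widetilde M^+,\mathcal{L}(K[r]))$ is formal. That is, every differential graded Lie algebra equivalent to $\big(A_{PL}(\widetilde M^+)\otimes\mathcal{L}(K[r])\big)^{C_2}$ (in particular that algebra itself) is formal. -/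

import Mathlib

open scoped TensorProduct DirectSum Manifold ContDiff

universe u v w

noncomputable section

/-! ### Signs -/

/-- The Koszul sign `(-1)^n`, as a rational number. -/
def koszul (n : ℤ) : ℚ := ((n.negOnePow : ℤˣ) : ℤ)

theorem koszul_add (m n : ℤ) : koszul (m + n) = koszul m * koszul n := by
  simp [koszul, Int.negOnePow_add]

theorem koszul_congr {m n : ℤ} (h : Even (m - n)) : koszul m = koszul n := by
  simp [koszul, (Int.negOnePow_eq_iff m n).2 h]

theorem koszul_zero : koszul 0 = 1 := by simp [koszul]

theorem koszul_one : koszul 1 = -1 := by simp [koszul]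

theorem koszul_mul_self (n : ℤ) : koszul n * koszul n = 1 := by
  rw [← koszul_add, ← koszul_zero]
  exact koszul_congr ⟨n, by ring⟩

theorem koszul_cases (n : ℤ) : koszul n = 1 ∨ koszul n = -1 := by
  rcases Int.even_or_odd n with h | h
  · left; simp [koszul, Int.negOnePow_even n h]
  · right; simp [koszul, Int.negOnePow_odd n h]

/-! ### Chain complexes, commutative algebras and Lie algebras

Everything is over `ℚ` and homologically graded: differentials have degree `-1`.  Structure maps
between graded pieces take the equation between the degrees as an argument. -/

/-- A chain complex of rational vector spaces, indexed by all integers. -/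
structure DGVect : Type (u + 1) where
  X : ℤ → Type u
  [acg : ∀ i, AddCommGroup (X i)]
  [mod : ∀ i, Module ℚ (X i)]
  d : ∀ {i j : ℤ}, j + 1 = i → X i →ₗ[ℚ] X j
  d_d : ∀ {i j k : ℤ} (h : j + 1 = i) (h' : k + 1 = j) (x : X i), d h' (d h x) = 0

attribute [instance] DGVect.acg DGVect.mod

/-- A (not necessarily unital) commutative differential graded algebra over `ℚ`. -/
structure CDGA : Type (u + 1) extends DGVect.{u} where
  mul : ∀ {i j k : ℤ}, i + j = k → X i →ₗ[ℚ] X j →ₗ[ℚ] X k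
  mul_assoc : ∀ {i j k ij jk n : ℤ} (h₁ : i + j = ij) (h₂ : ij + k = n) (h₃ : j + k = jk)
    (h₄ : i + jk = n) (x : X i) (y : X j) (z : X k),
    mul h₂ (mul h₁ x y) z = mul h₄ x (mul h₃ y z)
  mul_comm : ∀ {i j k : ℤ} (h : i + j = k) (h' : j + i = k) (x : X i) (y : X j),
    mul h x y = koszul (i * j) • mul h' y x
  d_mul : ∀ {i j k i' j' k' : ℤ} (h : i + j = k) (hi : i' + 1 = i) (hj : j' + 1 = j)
    (hk : k' + 1 = k) (h₁ : i' + j = k') (h₂ : i + j' = k') (x : X i) (y : X j),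
    d hk (mul h x y) = mul h₁ (d hi x) y + koszul i • mul h₂ x (d hj y)

/-- A differential graded Lie algebra over `ℚ`. -/
structure DGLie : Type (u + 1) extends DGVect.{u} where
  br : ∀ {i j k : ℤ}, i + j = k → X i →ₗ[ℚ] X j →ₗ[ℚ] X k
  br_antisymm : ∀ {i j k : ℤ} (h : i + j = k) (h' : j + i = k) (x : X i) (y : X j),
    br h x y = -(koszul (i * j) • br h' y x)
  jacobi : ∀ {i j k ij jk ik n : ℤ} (hij : i + j = ij) (hjk : j + k = jk) (hik : i + k = ik)
    (h₁ : i + jk = n) (h₂ : ij + k = n) (h₃ : j + ik = n) (x : X i) (y : X j) (z : X k),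
    br h₁ x (br hjk y z) = br h₂ (br hij x y) z + koszul (i * j) • br h₃ y (br hik x z)
  d_br : ∀ {i j k i' j' k' : ℤ} (h : i + j = k) (hi : i' + 1 = i) (hj : j' + 1 = j)
    (hk : k' + 1 = k) (h₁ : i' + j = k') (h₂ : i + j' = k') (x : X i) (y : X j),
    d hk (br h x y) = br h₁ (d hi x) y + koszul i • br h₂ x (d hj y)

/-- A morphism of commutative differential graded algebras. -/
@[ext]
structure CDGA.Hom (A : CDGA.{u}) (B : CDGA.{v}) where
  f : ∀ i, A.X i →ₗ[ℚ] B.X i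
  f_d : ∀ {i j : ℤ} (h : j + 1 = i) (x : A.X i), f j (A.d h x) = B.d h (f i x)
  f_mul : ∀ {i j k : ℤ} (h : i + j = k) (x : A.X i) (y : A.X j),
    f k (A.mul h x y) = B.mul h (f i x) (f j y)

/-- A morphism of differential graded Lie algebras. -/
@[ext]
structure DGLie.Hom (g : DGLie.{u}) (h : DGLie.{v}) where
  f : ∀ i, g.X i →ₗ[ℚ] h.X i
  f_d : ∀ {i j : ℤ} (e : j + 1 = i) (x : g.X i), f j (g.d e x) = h.d e (f i x)
  f_br : ∀ {i j k : ℤ} (e : i + j = k) (x : g.X i) (y : g.X j),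
    f k (g.br e x y) = h.br e (f i x) (f j y)

/-! ### Homology -/

namespace DGVect

variable (V : DGVect.{u})

/-- Cycles of degree `i`. -/
def cycles (i : ℤ) : Submodule ℚ (V.X i) := LinearMap.ker (V.d (sub_add_cancel i 1))

/-- Boundaries of degree `i`. -/
def boundaries (i : ℤ) : Submodule ℚ (V.X i) := LinearMap.range (V.d (rfl : i + 1 = i + 1))

theorem mem_cycles {i j : ℤ} (h : j + 1 = i) (x : V.X i) : x ∈ V.cycles i ↔ V.d h x = 0 := by
  obtain rfl : j = i - 1 := by omega
  exact Iff.rfl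

theorem mem_boundaries {i k : ℤ} (h : i + 1 = k) (x : V.X i) :
    x ∈ V.boundaries i ↔ ∃ y, V.d h y = x := by
  subst h
  exact Iff.rfl

/-- The homology `H_i(V)`: cycles modulo boundaries. -/
abbrev H (i : ℤ) : Type u := V.cycles i ⧸ (V.boundaries i).submoduleOf (V.cycles i)

/-- The homology class of a cycle. -/
def cls {i : ℤ} (x : V.cycles i) : V.H i := Submodule.Quotient.mk x

end DGVect

namespace DGLie

variable (g : DGLie.{u})

theorem br_mem_cycles {i j k : ℤ} (h : i + j = k) {x : g.X i} {y : g.X j}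
    (hx : x ∈ g.cycles i) (hy : y ∈ g.cycles j) : g.br h x y ∈ g.cycles k := by
  have hx' := (g.mem_cycles (sub_add_cancel i 1) x).1 hx
  have hy' := (g.mem_cycles (sub_add_cancel j 1) y).1 hy
  rw [g.mem_cycles (sub_add_cancel k 1), g.d_br h (sub_add_cancel i 1) (sub_add_cancel j 1) _
    (by omega) (by omega), hx', hy']
  simp

/-- The bracket restricted to cycles. -/
def cyclesBr {i j k : ℤ} (h : i + j = k) :
    g.cycles i →ₗ[ℚ] g.cycles j →ₗ[ℚ] g.cycles k :=
  LinearMap.mk₂ ℚ (fun x y => ⟨g.br h x.1 y.1, g.br_mem_cycles h x.2 y.2⟩)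
    (fun _ _ _ => Subtype.ext (by simp)) (fun _ _ _ => Subtype.ext (by simp))
    (fun _ _ _ => Subtype.ext (by simp)) (fun _ _ _ => Subtype.ext (by simp))

theorem br_boundary_left {i j k : ℤ} (h : i + j = k) {x : g.X i} {y : g.X j}
    (hx : x ∈ g.boundaries i) (hy : y ∈ g.cycles j) : g.br h x y ∈ g.boundaries k := by
  obtain ⟨z, rfl⟩ := (g.mem_boundaries rfl x).1 hx
  have hy' := (g.mem_cycles (sub_add_cancel j 1) y).1 hy
  refine (g.mem_boundaries rfl _).2 ⟨g.br (show i + 1 + j = k + 1 by omega) z y, ?_⟩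
  rw [g.d_br _ rfl (sub_add_cancel j 1) rfl h (by omega), hy']
  simp

theorem br_boundary_right {i j k : ℤ} (h : i + j = k) {x : g.X i} {y : g.X j}
    (hx : x ∈ g.cycles i) (hy : y ∈ g.boundaries j) : g.br h x y ∈ g.boundaries k := by
  rw [g.br_antisymm h (by omega)]
  exact Submodule.neg_mem _ (Submodule.smul_mem _ _ (g.br_boundary_left _ hy hx))

/-- The bracket induced on homology. -/
def homologyBr {i j k : ℤ} (h : i + j = k) : g.H i →ₗ[ℚ] g.H j →ₗ[ℚ] g.H k :=
  Submodule.liftQ _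
    (LinearMap.flip (Submodule.liftQ _
      (LinearMap.flip ((g.cyclesBr h).compr₂ (Submodule.mkQ _)))
      (by
        intro y hy
        ext x
        exact (Submodule.Quotient.mk_eq_zero _).2 (g.br_boundary_right h x.2 hy))))
    (by
      intro x hx
      ext y
      exact (Submodule.Quotient.mk_eq_zero _).2 (g.br_boundary_left h hx y.2))

theorem homologyBr_cls {i j k : ℤ} (h : i + j = k) (x : g.cycles i) (y : g.cycles j) :
    g.homologyBr h (g.cls x) (g.cls y) = g.cls (g.cyclesBr h x y) := rfl

/-- The homology of a differential graded Lie algebra: a graded Lie algebra, regarded as a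
differential graded Lie algebra with zero differential. -/
def homology : DGLie.{u} where
  X := g.H
  d := fun _ => 0
  d_d := fun _ _ _ => rfl
  br := g.homologyBr
  br_antisymm := by
    intro i j k h h' x y
    obtain ⟨x, rfl⟩ := Submodule.Quotient.mk_surjective _ x
    obtain ⟨y, rfl⟩ := Submodule.Quotient.mk_surjective _ y
    exact congrArg g.cls (Subtype.ext (g.br_antisymm h h' x.1 y.1) :
      g.cyclesBr h x y = -(koszul (i * j) • g.cyclesBr h' y x))
  jacobi := by
    intro i j k ij jk ik n hij hjk hik h₁ h₂ h₃ x y z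
    obtain ⟨x, rfl⟩ := Submodule.Quotient.mk_surjective _ x
    obtain ⟨y, rfl⟩ := Submodule.Quotient.mk_surjective _ y
    obtain ⟨z, rfl⟩ := Submodule.Quotient.mk_surjective _ z
    exact congrArg g.cls (Subtype.ext (g.jacobi hij hjk hik h₁ h₂ h₃ x.1 y.1 z.1) :
      g.cyclesBr h₁ x (g.cyclesBr hjk y z) =
        g.cyclesBr h₂ (g.cyclesBr hij x y) z + koszul (i * j) • g.cyclesBr h₃ y (g.cyclesBr hik x z))
  d_br := by
    intros
    simp

end DGLie

/-! ### Quasi-isomorphisms and formality -/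

namespace DGLie

variable {g : DGLie.{u}} {h : DGLie.{v}}

/-- The map induced on homology. -/
def Hom.homologyMap (φ : Hom g h) (i : ℤ) : g.H i →ₗ[ℚ] h.H i :=
  Submodule.mapQ _ _
    ((φ.f i).restrict (p := g.cycles i) (q := h.cycles i) (by
      intro x hx
      rw [h.mem_cycles (sub_add_cancel i 1), ← φ.f_d, (g.mem_cycles _ x).1 hx, map_zero]))
    (by
      rintro x hx
      obtain ⟨y, hy⟩ := (g.mem_boundaries rfl x.1).1 hx
      exact (h.mem_boundaries rfl _).2 ⟨φ.f _ y, by rw [← φ.f_d, hy]; rfl⟩)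

/-- A morphism is a quasi-isomorphism if it is bijective on homology in every degree. -/
def Hom.IsQuasiIso (φ : Hom g h) : Prop := ∀ i, Function.Bijective (φ.homologyMap i)

/-- Two differential graded Lie algebras are equivalent if they are connected by a finite zig-zag
of quasi-isomorphisms of differential graded Lie algebras. -/
def Equivalent (g h : DGLie.{u}) : Prop :=
  Relation.EqvGen (fun a b : DGLie.{u} => ∃ φ : Hom a b, φ.IsQuasiIso) g h

/-- A differential graded Lie algebra is formal if it is equivalent to its homology. -/
def IsFormal (g : DGLie.{u}) : Prop := Equivalent g g.homology

/-- The elements fixed by a family of endomorphisms (for instance by a group action). -/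
def invariants (g : DGLie.{u}) {G : Type w} (ρ : G → Hom g g) : DGLie.{u} where
  X i := ↥(⨅ a : G, LinearMap.eqLocus ((ρ a).f i) LinearMap.id)
  d := fun h => (g.d h).restrict (by
    intro x hx
    simp only [Submodule.mem_iInf, LinearMap.mem_eqLocus, LinearMap.id_apply] at hx ⊢
    intro a
    rw [(ρ a).f_d, hx a])
  d_d := fun h h' x => Subtype.ext (g.d_d h h' x.1)
  br := fun {i j k} h => LinearMap.mk₂ ℚ (fun x y => ⟨g.br h x.1 y.1, by
      have hx := x.2
      have hy := y.2
      simp only [Submodule.mem_iInf, LinearMap.mem_eqLocus, LinearMap.id_apply] at hx hy ⊢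
      intro a
      rw [(ρ a).f_br, hx a, hy a]⟩)
    (fun _ _ _ => Subtype.ext (by simp)) (fun _ _ _ => Subtype.ext (by simp))
    (fun _ _ _ => Subtype.ext (by simp)) (fun _ _ _ => Subtype.ext (by simp))
  br_antisymm := fun h h' x y => Subtype.ext (g.br_antisymm h h' x.1 y.1)
  jacobi := fun hij hjk hik h₁ h₂ h₃ x y z =>
    Subtype.ext (g.jacobi hij hjk hik h₁ h₂ h₃ x.1 y.1 z.1)
  d_br := fun h hi hj hk h₁ h₂ x y => Subtype.ext (g.d_br h hi hj hk h₁ h₂ x.1 y.1)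

end DGLie

/-! ### The tensor product of a commutative algebra and a Lie algebra -/

namespace CDGA

variable (A : CDGA.{u}) (g : DGLie.{v})

/-- Pairs of degrees adding up to `n`. -/
abbrev Bideg (n : ℤ) : Type := {p : ℤ × ℤ // p.1 + p.2 = n}

/-- The degree `n` part of `A ⊗ g`. -/
abbrev TensorX (n : ℤ) : Type (max u v) := ⨁ p : Bideg n, A.X p.1.1 ⊗[ℚ] g.X p.1.2

variable {A g}

/-- The homogeneous element `a ⊗ v` of `A ⊗ g`. -/
def tmul {i j n : ℤ} (h : i + j = n) (a : A.X i) (v : g.X j) : TensorX A g n :=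
  DirectSum.lof ℚ (Bideg n) (fun p => A.X p.1.1 ⊗[ℚ] g.X p.1.2) ⟨(i, j), h⟩ (a ⊗ₜ v)

theorem tmul_induction {n : ℤ} {P : TensorX A g n → Prop} (x : TensorX A g n) (h0 : P 0)
    (hadd : ∀ x y, P x → P y → P (x + y))
    (ht : ∀ (i j : ℤ) (h : i + j = n) (a : A.X i) (v : g.X j), P (tmul h a v)) : P x := by
  induction x using DirectSum.induction_on with
  | zero => exact h0
  | add x y hx hy => exact hadd x y hx hy
  | of p t =>
    obtain ⟨⟨i, j⟩, h⟩ := p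
    induction t using TensorProduct.induction_on with
    | zero => simpa using h0
    | add x y hx hy => simpa using hadd _ _ hx hy
    | tmul a v => exact ht i j h a v

variable (A g)

/-- The differential `d (a ⊗ v) = d a ⊗ v + (-1)^{|a|} a ⊗ d v`. -/
def tensorD {m n : ℤ} (h : n + 1 = m) : TensorX A g m →ₗ[ℚ] TensorX A g n :=
  DirectSum.toModule ℚ _ _ fun p =>
    (DirectSum.lof ℚ (Bideg n) (fun p => A.X p.1.1 ⊗[ℚ] g.X p.1.2)
        ⟨(p.1.1 - 1, p.1.2), by have := p.2; simp only; omega⟩).comp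
      (TensorProduct.map (A.d (sub_add_cancel p.1.1 1)) LinearMap.id) +
    koszul p.1.1 • (DirectSum.lof ℚ (Bideg n) (fun p => A.X p.1.1 ⊗[ℚ] g.X p.1.2)
        ⟨(p.1.1, p.1.2 - 1), by have := p.2; simp only; omega⟩).comp
      (TensorProduct.map LinearMap.id (g.d (sub_add_cancel p.1.2 1)))

/-- The bracket `[a ⊗ v, b ⊗ w] = (-1)^{|v||b|} a b ⊗ [v, w]`. -/
def tensorBr {m n k : ℤ} (h : m + n = k) :
    TensorX A g m →ₗ[ℚ] TensorX A g n →ₗ[ℚ] TensorX A g k :=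
  DirectSum.toModule ℚ _ _ fun p => LinearMap.flip <|
    DirectSum.toModule ℚ _ _ fun q => LinearMap.flip <|
      koszul (p.1.2 * q.1.1) •
        (TensorProduct.map₂ (A.mul (rfl : p.1.1 + q.1.1 = p.1.1 + q.1.1))
          (g.br (rfl : p.1.2 + q.1.2 = p.1.2 + q.1.2))).compr₂
        (DirectSum.lof ℚ (Bideg k) (fun p => A.X p.1.1 ⊗[ℚ] g.X p.1.2)
          ⟨(p.1.1 + q.1.1, p.1.2 + q.1.2), by have := p.2; have := q.2; simp only; omega⟩)

variable {A g}

theorem tensorD_tmul {m n i j i' j' : ℤ} (e : n + 1 = m) (h : i + j = m) (hi : i' + 1 = i)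
    (hj : j' + 1 = j) (a : A.X i) (v : g.X j) :
    tensorD A g e (tmul h a v) = tmul (by omega) (A.d hi a) v +
      koszul i • tmul (by omega) a (g.d hj v) := by
  obtain rfl : i' = i - 1 := by omega
  obtain rfl : j' = j - 1 := by omega
  simp [tensorD, tmul]

theorem tensorBr_tmul {m n k i j i' j' a b : ℤ} (e : m + n = k) (h : i + j = m) (h' : i' + j' = n)
    (ha : i + i' = a) (hb : j + j' = b)
    (x : A.X i) (v : g.X j) (y : A.X i') (w : g.X j') :
    tensorBr A g e (tmul h x v) (tmul h' y w) =
      koszul (j * i') • tmul (by omega) (A.mul ha x y) (g.br hb v w) := by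
  subst ha hb
  simp [tensorBr, tmul]

theorem tmul_add_left {i j n : ℤ} (h : i + j = n) (a b : A.X i) (v : g.X j) :
    tmul h (a + b) v = tmul h a v + tmul h b v := by
  simp [tmul, TensorProduct.add_tmul]

theorem tmul_add_right {i j n : ℤ} (h : i + j = n) (a : A.X i) (v w : g.X j) :
    tmul h a (v + w) = tmul h a v + tmul h a w := by
  simp [tmul, TensorProduct.tmul_add]

theorem tmul_smul_left {i j n : ℤ} (h : i + j = n) (c : ℚ) (a : A.X i) (v : g.X j) :
    tmul h (c • a) v = c • tmul h a v := by
  rw [tmul, ← TensorProduct.smul_tmul', map_smul, tmul]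

theorem tmul_smul_right {i j n : ℤ} (h : i + j = n) (c : ℚ) (a : A.X i) (v : g.X j) :
    tmul h a (c • v) = c • tmul h a v := by
  simp [tmul]

theorem tmul_neg_right {i j n : ℤ} (h : i + j = n) (a : A.X i) (v : g.X j) :
    tmul h a (-v) = -tmul h a v := by
  simp [tmul, TensorProduct.tmul_neg]

theorem tmul_zero_left {i j n : ℤ} (h : i + j = n) (v : g.X j) :
    tmul h (0 : A.X i) v = 0 := by
  simp [tmul]

theorem tmul_zero_right {i j n : ℤ} (h : i + j = n) (a : A.X i) :
    tmul h a (0 : g.X j) = 0 := by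
  simp [tmul]

variable (A g)

/-- The differential graded Lie algebra `A ⊗ g`. -/
def tensorLie : DGLie.{max u v} where
  X := TensorX A g
  d := tensorD A g
  d_d := by
    intro i j k h h' x
    induction x using tmul_induction with
    | h0 => simp
    | hadd x y hx hy => simp [hx, hy]
    | ht p q e a v =>
      rw [tensorD_tmul h e (sub_add_cancel p 1) (sub_add_cancel q 1), map_add, map_smul,
        tensorD_tmul h' _ (sub_add_cancel (p - 1) 1) (sub_add_cancel q 1),
        tensorD_tmul h' _ (sub_add_cancel p 1) (sub_add_cancel (q - 1) 1), A.d_d, g.d_d,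
        tmul_zero_left, tmul_zero_right]
      have : koszul p = - koszul (p - 1) := by
        conv_lhs => rw [← sub_add_cancel p 1, koszul_add, koszul_one]
        ring
      rw [this]
      module
  br := tensorBr A g
  br_antisymm := by
    intro m n k h h' x y
    induction x using tmul_induction with
    | h0 => simp
    | hadd x x' hx hx' => simp only [map_add, LinearMap.add_apply, hx, hx', smul_add, neg_add]
    | ht p q e a v =>
      induction y using tmul_induction with
      | h0 => simp
      | hadd y y' hy hy' => simp only [map_add, LinearMap.add_apply, hy, hy', smul_add, neg_add]
      | ht p' q' e' b w =>
        rw [tensorBr_tmul h e e' rfl rfl, tensorBr_tmul h' e' e (add_comm p' p) (add_comm q' q),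
          A.mul_comm rfl (add_comm p' p), g.br_antisymm rfl (add_comm q' q), tmul_neg_right,
          tmul_smul_left, tmul_smul_right]
        simp only [smul_neg, smul_smul, neg_inj, ← koszul_add]
        congr 1
        subst e e'
        exact koszul_congr ⟨-(q' * p), by ring⟩
  jacobi := by
    intro i j k ij jk ik n hij hjk hik h₁ h₂ h₃ x y z
    induction x using tmul_induction with
    | h0 => simp
    | hadd x x' hx hx' =>
      simp only [map_add, LinearMap.add_apply, hx, hx', smul_add]
      abel
    | ht p q e a v =>
      induction y using tmul_induction with
      | h0 => simp
      | hadd x x' hx hx' =>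
        simp only [map_add, LinearMap.add_apply, hx, hx', smul_add]
        abel
      | ht p' q' e' b w =>
        induction z using tmul_induction with
        | h0 => simp
        | hadd x x' hx hx' =>
          simp only [map_add, hx, hx', smul_add]
          abel
        | ht p'' q'' e'' c z =>
          rw [tensorBr_tmul hjk e' e'' rfl rfl, tensorBr_tmul hij e e' rfl rfl,
            tensorBr_tmul hik e e'' rfl rfl]
          simp only [map_smul, LinearMap.smul_apply]
          rw [tensorBr_tmul (a := p + p' + p'') (b := q + q' + q'') h₁ e _ (by ring) (by ring),
            tensorBr_tmul (a := p + p' + p'') (b := q + q' + q'') h₂ _ e'' (by ring) (by ring),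
            tensorBr_tmul (a := p + p' + p'') (b := q + q' + q'') h₃ e' _ (by ring) (by ring),
            g.jacobi rfl rfl rfl _ rfl (by ring),
            tmul_add_right, tmul_smul_right]
          have e1 : A.mul (show p + (p' + p'') = p + p' + p'' by ring) a (A.mul rfl b c) =
              A.mul rfl (A.mul rfl a b) c := (A.mul_assoc _ _ _ _ a b c).symm
          have e2 : A.mul (show p' + (p + p'') = p + p' + p'' by ring) b (A.mul rfl a c) =
              koszul (p' * p) • A.mul rfl (A.mul rfl a b) c := by
            rw [← A.mul_assoc (add_comm p' p) rfl, A.mul_comm (add_comm p' p) rfl b a]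
            simp
          rw [e1, e2, tmul_smul_left]
          simp only [smul_add, smul_smul, ← koszul_add]
          congr 2
          · exact koszul_congr ⟨0, by ring⟩
          · exact koszul_congr ⟨-(p' * p) - p * q', by rw [← e, ← e']; ring⟩
  d_br := by
    intro i j k i' j' k' h hi hj hk h₁ h₂ x y
    induction x using tmul_induction with
    | h0 => simp
    | hadd x x' hx hx' =>
      simp only [map_add, LinearMap.add_apply, hx, hx', smul_add]
      abel
    | ht p q e a v =>
      induction y using tmul_induction with
      | h0 => simp
      | hadd x x' hx hx' =>
        simp only [map_add, hx, hx', smul_add]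
        abel
      | ht p' q' e' b w =>
        rw [tensorBr_tmul h e e' rfl rfl, map_smul,
          tensorD_tmul (i' := p + p' - 1) (j' := q + q' - 1) hk _ (by ring) (by ring),
          tensorD_tmul hi e (sub_add_cancel p 1) (sub_add_cancel q 1),
          tensorD_tmul hj e' (sub_add_cancel p' 1) (sub_add_cancel q' 1)]
        simp only [map_smul, map_add, LinearMap.add_apply, LinearMap.smul_apply]
        rw [A.d_mul rfl (sub_add_cancel p 1) (sub_add_cancel p' 1) _ (by ring) (by ring),
          g.d_br rfl (sub_add_cancel q 1) (sub_add_cancel q' 1) _ (by ring) (by ring),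
          tensorBr_tmul (a := p + p' - 1) (b := q + q') h₁ _ e' (by ring) rfl,
          tensorBr_tmul (a := p + p') (b := q + q' - 1) h₁ _ e' (by ring) (by ring),
          tensorBr_tmul (a := p + p' - 1) (b := q + q') h₂ e _ (by ring) rfl,
          tensorBr_tmul (a := p + p') (b := q + q' - 1) h₂ e _ (by ring) (by ring),
          tmul_add_left, tmul_add_right, tmul_smul_left, tmul_smul_right]
        simp only [smul_add, smul_smul, ← koszul_add]
        rw [koszul_congr (m := q * p' + (p + p')) (n := p + (q - 1) * p') ⟨p', by ring⟩,
          koszul_congr (m := q * p' + p) (n := i + q * (p' - 1)) ⟨0, by rw [← e]; ring⟩,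
          koszul_congr (m := q * p' + (p + p' + q)) (n := i + (p' + q * p')) ⟨0, by rw [← e]; ring⟩]
        abel

variable {A g} {B : CDGA.{u}} {h : DGLie.{v}}

/-- The map `φ ⊗ ψ` in degree `n`. -/
def tensorMapX (φ : A.Hom B) (ψ : g.Hom h) (n : ℤ) : TensorX A g n →ₗ[ℚ] TensorX B h n :=
  DirectSum.toModule ℚ _ _ fun p =>
    (DirectSum.lof ℚ (Bideg n) (fun p => B.X p.1.1 ⊗[ℚ] h.X p.1.2) p).comp
      (TensorProduct.map (φ.f p.1.1) (ψ.f p.1.2))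

theorem tensorMapX_tmul (φ : A.Hom B) (ψ : g.Hom h) {n p q : ℤ} (e : p + q = n) (a : A.X p)
    (v : g.X q) : tensorMapX φ ψ n (tmul e a v) = tmul e (φ.f p a) (ψ.f q v) := by
  simp [tensorMapX, tmul]

/-- The morphism `φ ⊗ ψ : A ⊗ g ⟶ B ⊗ h`. -/
def tensorLieMap (φ : A.Hom B) (ψ : g.Hom h) : (tensorLie A g).Hom (tensorLie B h) where
  f := tensorMapX φ ψ
  f_d := by
    intro i j e x
    change tensorMapX φ ψ j (tensorD A g e x) = tensorD B h e (tensorMapX φ ψ i x)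
    induction x using tmul_induction with
    | h0 => simp
    | hadd x y hx hy => simp only [map_add, hx, hy]
    | ht p q e' a v =>
      rw [tensorD_tmul e e' (sub_add_cancel p 1) (sub_add_cancel q 1), map_add, map_smul,
        tensorMapX_tmul, tensorMapX_tmul, tensorMapX_tmul,
        tensorD_tmul e e' (sub_add_cancel p 1) (sub_add_cancel q 1), φ.f_d, ψ.f_d]
  f_br := by
    intro i j k e (x : TensorX A g i) (y : TensorX A g j)
    change tensorMapX φ ψ k (tensorBr A g e x y) =
      tensorBr B h e (tensorMapX φ ψ i x) (tensorMapX φ ψ j y)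
    induction x using tmul_induction with
    | h0 => simp
    | hadd x y hx hy => simp only [map_add, LinearMap.add_apply, hx, hy]
    | ht p q e' a v =>
      induction y using tmul_induction with
      | h0 => simp
      | hadd x y hx hy => simp only [map_add, hx, hy]
      | ht p' q' e'' b w =>
        rw [tensorBr_tmul e e' e'' rfl rfl, map_smul, tensorMapX_tmul, tensorMapX_tmul,
          tensorMapX_tmul, tensorBr_tmul e e' e'' rfl rfl, φ.f_mul, ψ.f_br]

end CDGA

/-! ### Polynomial differential forms on simplices -/

namespace PolyForm

/-- Generators of the algebra of polynomial forms on the `n`-simplex: `inl i` is the barycentric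
coordinate `t_i` and `inr i` is its differential `dt_i`. -/
abbrev Gen (n : ℕ) : Type := Fin (n + 1) ⊕ Fin (n + 1)

/-- `t_i` in the free algebra. -/
def preT {n : ℕ} (i : Fin (n + 1)) : FreeAlgebra ℚ (Gen n) := FreeAlgebra.ι ℚ (Sum.inl i)

/-- `dt_i` in the free algebra. -/
def preDt {n : ℕ} (i : Fin (n + 1)) : FreeAlgebra ℚ (Gen n) := FreeAlgebra.ι ℚ (Sum.inr i)

/-- The relations: graded commutativity, `∑ t_i = 1` and `∑ dt_i = 0`. -/
inductive FormRel (n : ℕ) : FreeAlgebra ℚ (Gen n) → FreeAlgebra ℚ (Gen n) → Prop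
  | tt_comm (i j : Fin (n + 1)) : FormRel n (preT i * preT j) (preT j * preT i)
  | tdt_comm (i j : Fin (n + 1)) : FormRel n (preT i * preDt j) (preDt j * preT i)
  | dtdt_comm (i j : Fin (n + 1)) : FormRel n (preDt i * preDt j) (-(preDt j * preDt i))
  | t_sum : FormRel n (∑ i, preT i) 1
  | dt_sum : FormRel n (∑ i, preDt i) 0

end PolyForm

/-- The algebra `(A_PL)_n` of polynomial differential forms with rational coefficients on the
`n`-simplex: the free graded commutative algebra on `t_0, …, t_n, dt_0, …, dt_n` modulo
`∑ t_i = 1` and `∑ dt_i = 0`. -/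
def PolyForm (n : ℕ) : Type := RingQuot (PolyForm.FormRel n)

namespace PolyForm

variable {n m : ℕ}

instance : Ring (PolyForm n) := inferInstanceAs (Ring (RingQuot (FormRel n)))

instance : Algebra ℚ (PolyForm n) := inferInstanceAs (Algebra ℚ (RingQuot (FormRel n)))

/-- The quotient map. -/
def mk : FreeAlgebra ℚ (Gen n) →ₐ[ℚ] PolyForm n := RingQuot.mkAlgHom ℚ (FormRel n)

theorem mk_rel {x y : FreeAlgebra ℚ (Gen n)} (h : FormRel n x y) : mk x = mk y :=
  RingQuot.mkAlgHom_rel ℚ h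

/-- The barycentric coordinate `t_i`. -/
def t (i : Fin (n + 1)) : PolyForm n := mk (preT i)

/-- The one-form `dt_i`. -/
def dt (i : Fin (n + 1)) : PolyForm n := mk (preDt i)

theorem t_comm (i j : Fin (n + 1)) : t i * t j = t j * t i := by
  simpa [t] using mk_rel (FormRel.tt_comm i j)

theorem t_dt_comm (i j : Fin (n + 1)) : t i * dt j = dt j * t i := by
  simpa [t, dt] using mk_rel (FormRel.tdt_comm i j)

theorem dt_anticomm (i j : Fin (n + 1)) : dt i * dt j = -(dt j * dt i) := by
  simpa [dt] using mk_rel (FormRel.dtdt_comm i j)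

theorem sum_t : ∑ i : Fin (n + 1), t i = 1 := by
  simpa [t] using mk_rel (FormRel.t_sum (n := n))

theorem sum_dt : ∑ i : Fin (n + 1), dt i = 0 := by
  simpa [dt] using mk_rel (FormRel.dt_sum (n := n))

/-- The universal property of polynomial forms. -/
def lift {B : Type*} [Ring B] [Algebra ℚ B] (a b : Fin (n + 1) → B)
    (hab : ∀ i j, a i * a j = a j * a i) (hac : ∀ i j, a i * b j = b j * a i)
    (hbb : ∀ i j, b i * b j = -(b j * b i)) (ha : ∑ i, a i = 1) (hb : ∑ i, b i = 0) :
    PolyForm n →ₐ[ℚ] B :=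
  RingQuot.liftAlgHom ℚ ⟨FreeAlgebra.lift ℚ (Sum.elim a b), by
    intro x y h
    cases h with
    | tt_comm i j => simpa [preT] using hab i j
    | tdt_comm i j => simpa [preT, preDt] using hac i j
    | dtdt_comm i j => simpa [preDt] using hbb i j
    | t_sum => simpa [preT] using ha
    | dt_sum => simpa [preDt] using hb⟩

section lift

variable {B : Type*} [Ring B] [Algebra ℚ B] (a b : Fin (n + 1) → B)
    (hab : ∀ i j, a i * a j = a j * a i) (hac : ∀ i j, a i * b j = b j * a i)
    (hbb : ∀ i j, b i * b j = -(b j * b i)) (ha : ∑ i, a i = 1) (hb : ∑ i, b i = 0)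

theorem lift_t (i : Fin (n + 1)) : lift a b hab hac hbb ha hb (t i) = a i :=
  (RingQuot.liftAlgHom_mkAlgHom_apply ℚ _ _ _).trans (by simp [preT])

theorem lift_dt (i : Fin (n + 1)) : lift a b hab hac hbb ha hb (dt i) = b i :=
  (RingQuot.liftAlgHom_mkAlgHom_apply ℚ _ _ _).trans (by simp [preDt])

end lift

theorem induction {P : PolyForm n → Prop} (x : PolyForm n)
    (hc : ∀ c : ℚ, P (algebraMap ℚ _ c)) (ht : ∀ i, P (t i)) (hdt : ∀ i, P (dt i))
    (hadd : ∀ x y, P x → P y → P (x + y)) (hmul : ∀ x y, P x → P y → P (x * y)) : P x := by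
  obtain ⟨x, rfl⟩ : ∃ y, mk y = x := RingQuot.mkAlgHom_surjective ℚ (FormRel n) x
  induction x using FreeAlgebra.induction with
  | grade0 c => simpa using hc c
  | grade1 g =>
    rcases g with i | i
    · exact ht i
    · exact hdt i
  | mul x y hx hy => simpa using hmul _ _ hx hy
  | add x y hx hy => simpa using hadd _ _ hx hy

/-- The parity automorphism, `x ↦ (-1)^{|x|} x`. -/
def parity : PolyForm n →ₐ[ℚ] PolyForm n :=
  lift t (fun i => -dt i) t_comm (fun i j => by simp [t_dt_comm i j])
    (fun i j => by simpa using dt_anticomm i j) sum_t (by simp [sum_dt])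

theorem parity_t (i : Fin (n + 1)) : parity (t i) = t i := lift_t ..

theorem parity_dt (i : Fin (n + 1)) : parity (dt i) = -dt i := lift_dt ..

/-- The algebra map sending `x` to the upper triangular matrix with diagonal
`((-1)^{|x|} x, x)` and upper right entry `d x`; multiplicativity is the graded Leibniz rule. -/
def dHom : PolyForm n →ₐ[ℚ] Matrix (Fin 2) (Fin 2) (PolyForm n) :=
  lift (fun i => !![t i, dt i; 0, t i]) (fun i => !![-dt i, 0; 0, dt i])
    (fun i j => by
      simp only [Matrix.mul_fin_two, mul_zero, zero_mul, add_zero, zero_add, t_comm i j,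
        t_dt_comm i j, ← t_dt_comm j i]
      rw [add_comm])
    (fun i j => by
      simp [t_dt_comm i j, dt_anticomm i j])
    (fun i j => by
      rw [Matrix.mul_fin_two, Matrix.mul_fin_two]
      ext a b
      fin_cases a <;> fin_cases b <;> simp [dt_anticomm i j])
    (by
      ext a b
      fin_cases a <;> fin_cases b <;> simp [Matrix.sum_apply, sum_t, sum_dt])
    (by
      ext a b
      fin_cases a <;> fin_cases b <;> simp [Matrix.sum_apply, sum_dt])

/-- The exterior derivative of polynomial forms: the unique graded derivation with
`d (t_i) = dt_i` and `d (dt_i) = 0`. -/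
def d : PolyForm n →ₗ[ℚ] PolyForm n where
  toFun x := dHom x 0 1
  map_add' x y := by simp
  map_smul' c x := by simp

theorem dHom_t (i : Fin (n + 1)) : dHom (t i) = !![t i, dt i; 0, t i] := lift_t ..

theorem dHom_dt (i : Fin (n + 1)) : dHom (dt i) = !![-dt i, 0; 0, dt i] := lift_dt ..

theorem d_t (i : Fin (n + 1)) : d (t i) = dt i := by
  simp [d, dHom_t]

theorem d_dt (i : Fin (n + 1)) : d (dt i) = 0 := by
  simp [d, dHom_dt]

theorem dHom_apply (x : PolyForm n) : dHom x = !![parity x, d x; 0, x] := by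
  have : dHom x 0 0 = parity x ∧ dHom x 1 0 = 0 ∧ dHom x 1 1 = x := by
    induction x using induction with
    | hc c => simp [Matrix.algebraMap_matrix_apply]
    | ht i => simp [dHom_t, parity_t]
    | hdt i => simp [dHom_dt, parity_dt]
    | hadd x y hx hy => simp [hx, hy]
    | hmul x y hx hy => simp [Matrix.mul_apply, Fin.sum_univ_two, hx, hy]
  ext a b
  fin_cases a <;> fin_cases b
  · exact this.1
  · rfl
  · exact this.2.1
  · exact this.2.2

theorem d_mul (x y : PolyForm n) : d (x * y) = d x * y + parity x * d y := by
  have := congrFun (congrFun (map_mul dHom x y) 0) 1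
  rw [dHom_apply x, dHom_apply y, dHom_apply (x * y), Matrix.mul_fin_two] at this
  simpa [add_comm] using this

theorem d_algebraMap (c : ℚ) : d (algebraMap ℚ (PolyForm n) c) = 0 := by
  simp [d, Matrix.algebraMap_matrix_apply]

theorem d_d_and (x : PolyForm n) : d (d x) = 0 ∧ parity (d x) = -d (parity x) := by
  induction x using induction with
  | hc c => simp [d_algebraMap]
  | ht i => simp [d_t, d_dt, parity_t, parity_dt]
  | hdt i => simp [d_dt, parity_dt]
  | hadd x y hx hy => simp [hx, hy]; abel
  | hmul x y hx hy =>
    simp only [d_mul, map_add, map_mul, hx, hy, zero_mul, mul_zero]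
    constructor
    · simp
    · simp only [neg_mul, mul_neg]; abel

theorem d_d (x : PolyForm n) : d (d x) = 0 := (d_d_and x).1

/-- Pullback of forms along the affine map of simplices given on vertices by `f`. -/
def pullback (f : Fin (m + 1) → Fin (n + 1)) : PolyForm n →ₐ[ℚ] PolyForm m :=
  lift (fun i => ∑ j with f j = i, t j) (fun i => ∑ j with f j = i, dt j)
    (fun i j => by
      rw [Finset.sum_mul_sum, Finset.sum_mul_sum, Finset.sum_comm]
      simp only [t_comm])
    (fun i j => by
      rw [Finset.sum_mul_sum, Finset.sum_mul_sum, Finset.sum_comm]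
      simp only [t_dt_comm])
    (fun i j => by
      rw [Finset.sum_mul_sum, Finset.sum_mul_sum, Finset.sum_comm]
      simp only [← Finset.sum_neg_distrib]
      exact Finset.sum_congr rfl fun a _ => Finset.sum_congr rfl fun b _ => dt_anticomm b a)
    (by rw [Finset.sum_fiberwise, sum_t])
    (by rw [Finset.sum_fiberwise, sum_dt])

theorem pullback_t (f : Fin (m + 1) → Fin (n + 1)) (i : Fin (n + 1)) :
    pullback f (t i) = ∑ j with f j = i, t j := lift_t ..

theorem pullback_dt (f : Fin (m + 1) → Fin (n + 1)) (i : Fin (n + 1)) :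
    pullback f (dt i) = ∑ j with f j = i, dt j := lift_dt ..

theorem pullback_d_and (f : Fin (m + 1) → Fin (n + 1)) (x : PolyForm n) :
    pullback f (d x) = d (pullback f x) ∧ pullback f (parity x) = parity (pullback f x) := by
  induction x using induction with
  | hc c => simp [d_algebraMap]
  | ht i => simp [d_t, pullback_t, pullback_dt, parity_t]
  | hdt i => simp [d_dt, pullback_dt, parity_dt]
  | hadd x y hx hy => simp [hx, hy]
  | hmul x y hx hy => simp [d_mul, hx, hy]

theorem pullback_d (f : Fin (m + 1) → Fin (n + 1)) (x : PolyForm n) :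
    pullback f (d x) = d (pullback f x) := (pullback_d_and f x).1

/-- `IsMonomial k x`: the form `x` is a product of factors `t_i` and `dt_i` with exactly `-k`
factors `dt_i`. -/
inductive IsMonomial : ℤ → PolyForm n → Prop
  | one : IsMonomial 0 1
  | t_mul {k : ℤ} {x : PolyForm n} (i : Fin (n + 1)) : IsMonomial k x → IsMonomial k (t i * x)
  | dt_mul {k : ℤ} {x : PolyForm n} (i : Fin (n + 1)) :
      IsMonomial k x → IsMonomial (k - 1) (dt i * x)

variable (n) in
/-- The forms of homological degree `k`, that is, the `(-k)`-forms. -/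
def homog (k : ℤ) : Submodule ℚ (PolyForm n) := Submodule.span ℚ {x | IsMonomial k x}

theorem t_mul_mem {k : ℤ} (i : Fin (n + 1)) {x : PolyForm n} (hx : x ∈ homog n k) :
    t i * x ∈ homog n k := by
  induction hx using Submodule.span_induction with
  | mem y hy => exact Submodule.subset_span (hy.t_mul i)
  | zero => simp
  | add x y _ _ hx hy => rw [mul_add]; exact add_mem hx hy
  | smul c x _ hx => rw [mul_smul_comm]; exact Submodule.smul_mem _ _ hx

theorem dt_mul_mem {k l : ℤ} (h : l + 1 = k) (i : Fin (n + 1)) {x : PolyForm n}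
    (hx : x ∈ homog n k) : dt i * x ∈ homog n l := by
  obtain rfl : l = k - 1 := by omega
  induction hx using Submodule.span_induction with
  | mem y hy => exact Submodule.subset_span (hy.dt_mul i)
  | zero => simp
  | add x y _ _ hx hy => rw [mul_add]; exact add_mem hx hy
  | smul c x _ hx => rw [mul_smul_comm]; exact Submodule.smul_mem _ _ hx

theorem mul_mem {k l j : ℤ} (h : k + l = j) {x y : PolyForm n} (hx : x ∈ homog n k)
    (hy : y ∈ homog n l) : x * y ∈ homog n j := by
  subst h
  induction hx using Submodule.span_induction with
  | mem x hx =>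
    induction hx with
    | one => simpa using hy
    | t_mul i _ ih => rw [mul_assoc]; exact t_mul_mem i ih
    | dt_mul i _ ih => rw [mul_assoc]; exact dt_mul_mem (by ring) i ih
  | zero => simp
  | add x y _ _ hx hy => rw [add_mul]; exact add_mem hx hy
  | smul c x _ hx => rw [smul_mul_assoc]; exact Submodule.smul_mem _ _ hx

theorem one_mem : (1 : PolyForm n) ∈ homog n 0 := Submodule.subset_span .one

theorem t_mem (i : Fin (n + 1)) : t i ∈ homog n 0 := by
  simpa using t_mul_mem i one_mem

theorem dt_mem (i : Fin (n + 1)) : dt i ∈ homog n (-1) := by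
  simpa using dt_mul_mem (l := -1) (by norm_num) i one_mem

theorem parity_of_mem {k : ℤ} {x : PolyForm n} (hx : x ∈ homog n k) :
    parity x = koszul k • x := by
  induction hx using Submodule.span_induction with
  | mem x hx =>
    induction hx with
    | one => simp [koszul_zero]
    | t_mul i _ ih => simp [ih, parity_t]
    | dt_mul i _ ih =>
      rw [map_mul, ih, parity_dt, sub_eq_add_neg, koszul_add,
        koszul_congr (m := -1) (n := 1) ⟨-1, by ring⟩, koszul_one]
      simp
  | zero => simp
  | add x y _ _ hx hy => simp [hx, hy]
  | smul c x _ hx => rw [map_smul, hx, smul_comm]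

theorem d_mem {k l : ℤ} (h : l + 1 = k) {x : PolyForm n} (hx : x ∈ homog n k) :
    d x ∈ homog n l := by
  obtain rfl : l = k - 1 := by omega
  induction hx using Submodule.span_induction with
  | mem x hx =>
    induction hx with
    | one => simpa using (d_algebraMap (n := n) 1) ▸ Submodule.zero_mem _
    | t_mul i hx ih =>
      rw [d_mul, d_t, parity_t]
      exact add_mem (dt_mul_mem (by ring) i (Submodule.subset_span hx)) (t_mul_mem i (ih (by ring)))
    | dt_mul i _ ih =>
      rw [d_mul, d_dt, parity_dt, zero_mul, zero_add, neg_mul]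
      exact Submodule.neg_mem _ (dt_mul_mem (by ring) i (ih (by ring)))
  | zero => simp
  | add x y _ _ hx hy => rw [map_add]; exact add_mem hx hy
  | smul c x _ hx => rw [map_smul]; exact Submodule.smul_mem _ _ hx

theorem pullback_mem (f : Fin (m + 1) → Fin (n + 1)) {k : ℤ} {x : PolyForm n}
    (hx : x ∈ homog n k) : pullback f x ∈ homog m k := by
  induction hx using Submodule.span_induction with
  | mem x hx =>
    induction hx with
    | one => simpa using one_mem
    | t_mul i _ ih =>
      rw [map_mul, pullback_t, Finset.sum_mul]
      exact Submodule.sum_mem _ fun j _ => t_mul_mem j ih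
    | dt_mul i _ ih =>
      rw [map_mul, pullback_dt, Finset.sum_mul]
      exact Submodule.sum_mem _ fun j _ => dt_mul_mem (by ring) j ih
  | zero => simp
  | add x y _ _ hx hy => rw [map_add]; exact add_mem hx hy
  | smul c x _ hx => rw [map_smul]; exact Submodule.smul_mem _ _ hx

theorem t_central (i : Fin (n + 1)) (x : PolyForm n) : t i * x = x * t i := by
  induction x using induction with
  | hc c => exact (Algebra.commutes c _).symm
  | ht j => exact t_comm i j
  | hdt j => exact t_dt_comm i j
  | hadd x y hx hy => rw [mul_add, add_mul, hx, hy]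
  | hmul x y hx hy => rw [← mul_assoc, hx, mul_assoc, hy, mul_assoc]

theorem dt_mul_eq (i : Fin (n + 1)) (x : PolyForm n) : dt i * x = parity x * dt i := by
  induction x using induction with
  | hc c => simpa using (Algebra.commutes c _).symm
  | ht j => rw [parity_t, t_central]
  | hdt j => rw [parity_dt, dt_anticomm, neg_mul]
  | hadd x y hx hy => rw [mul_add, map_add, add_mul, hx, hy]
  | hmul x y hx hy => rw [← mul_assoc, hx, mul_assoc, hy, map_mul, mul_assoc]

theorem mul_comm_of_mem {k l : ℤ} {x y : PolyForm n} (hx : x ∈ homog n k)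
    (hy : y ∈ homog n l) : x * y = koszul (k * l) • (y * x) := by
  induction hx using Submodule.span_induction with
  | mem x hx =>
    induction hx with
    | one => simp [koszul_zero]
    | t_mul i _ ih => rw [mul_assoc, ih, mul_smul_comm, ← mul_assoc, t_central, mul_assoc]
    | @dt_mul k x i _ ih =>
      rw [mul_assoc, ih, mul_smul_comm, ← mul_assoc, dt_mul_eq, parity_of_mem hy, smul_mul_assoc,
        smul_mul_assoc, smul_smul, mul_assoc, ← koszul_add]
      congr 1
      exact koszul_congr ⟨l, by ring⟩
  | zero => simp
  | add x y _ _ hx hy => rw [add_mul, mul_add, hx, hy, smul_add]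
  | smul c x _ hx => rw [smul_mul_assoc, mul_smul_comm, hx, smul_comm]

end PolyForm

/-! ### Polynomial forms on simplicial sets and on spaces -/

open CategoryTheory Opposite

namespace SSet

/-- The underlying function on vertices of a morphism in the simplex category. -/
abbrev vertexMap {m n : ℕ} (f : SimplexCategory.mk m ⟶ SimplexCategory.mk n) : Fin (m + 1) → Fin (n + 1) :=
  fun i => f.toOrderHom i

/-- All families assigning to each simplex of `S` a polynomial form on that simplex. -/
abbrev FormFamily (S : SSet.{u}) : Type u := ∀ n : ℕ, S.obj (op (SimplexCategory.mk n)) → PolyForm n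

/-- The reduced polynomial forms of homological degree `k` on a simplicial set `S` with base
point `s`: families of `(-k)`-forms on the simplices of `S` that are compatible with all
simplicial operators and vanish on the base point and its degeneracies. -/
def aPLX (S : SSet.{u}) (s : S.obj (op (SimplexCategory.mk 0))) (k : ℤ) : Submodule ℚ S.FormFamily where
  carrier := {α |
    (∀ (n : ℕ) (σ : S.obj (op (SimplexCategory.mk n))), α n σ ∈ PolyForm.homog n k) ∧
    (∀ (m n : ℕ) (f : SimplexCategory.mk m ⟶ SimplexCategory.mk n) (σ : S.obj (op (SimplexCategory.mk n))),
      α m (S.map f.op σ) = PolyForm.pullback (vertexMap f) (α n σ)) ∧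
    (∀ (n : ℕ) (f : SimplexCategory.mk n ⟶ SimplexCategory.mk 0), α n (S.map f.op s) = 0)}
  zero_mem' := ⟨fun _ _ => Submodule.zero_mem _, fun _ _ _ _ => (map_zero _).symm, fun _ _ => rfl⟩
  add_mem' := by
    rintro α β ⟨h₁, h₂, h₃⟩ ⟨h₁', h₂', h₃'⟩
    refine ⟨fun n σ => add_mem (h₁ n σ) (h₁' n σ), fun m n f σ => ?_, fun n f => ?_⟩
    · simp [h₂, h₂']
    · simp [h₃, h₃']
  smul_mem' := by
    rintro c α ⟨h₁, h₂, h₃⟩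
    refine ⟨fun n σ => Submodule.smul_mem _ _ (h₁ n σ), fun m n f σ => ?_, fun n f => ?_⟩
    · simp [h₂]
    · simp [h₃]

/-- The nonunital commutative differential graded algebra of reduced polynomial forms on a pointed
simplicial set. -/
def aPL (S : SSet.{u}) (s : S.obj (op (SimplexCategory.mk 0))) : CDGA.{u} where
  X k := ↥(aPLX S s k)
  d := fun {i j} h =>
    { toFun := fun α => ⟨fun n σ => PolyForm.d (α.1 n σ),
        fun n σ => PolyForm.d_mem h (α.2.1 n σ),
        fun m n f σ => by dsimp only; rw [α.2.2.1, PolyForm.pullback_d],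
        fun n f => by dsimp only; rw [α.2.2.2, map_zero]⟩
      map_add' := fun α β => by ext; simp
      map_smul' := fun c α => by ext; simp }
  d_d := fun h h' α => by
    ext n σ
    exact PolyForm.d_d _
  mul := fun {i j k} h => LinearMap.mk₂ ℚ
    (fun α β => ⟨fun n σ => α.1 n σ * β.1 n σ,
        fun n σ => PolyForm.mul_mem h (α.2.1 n σ) (β.2.1 n σ),
        fun m n f σ => by dsimp only; rw [α.2.2.1, β.2.2.1, map_mul],
        fun n f => by dsimp only; rw [α.2.2.2, zero_mul]⟩)
    (fun α α' β => by ext n σ; exact add_mul _ _ _)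
    (fun c α β => by ext n σ; exact smul_mul_assoc c (α.1 n σ) (β.1 n σ))
    (fun α β β' => by ext n σ; exact mul_add _ _ _)
    (fun c α β => by ext n σ; exact mul_smul_comm c (α.1 n σ) (β.1 n σ))
  mul_assoc := fun _ _ _ _ α β γ => by
    ext n σ
    exact mul_assoc _ _ _
  mul_comm := fun _ _ α β => by
    ext n σ
    exact PolyForm.mul_comm_of_mem (α.2.1 n σ) (β.2.1 n σ)
  d_mul := fun {i j k i' j' k'} h hi hj hk h₁ h₂ α β => by
    ext n σ
    change PolyForm.d (α.1 n σ * β.1 n σ) = PolyForm.d (α.1 n σ) * β.1 n σ +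
      koszul i • (α.1 n σ * PolyForm.d (β.1 n σ))
    rw [PolyForm.d_mul, PolyForm.parity_of_mem (α.2.1 n σ), smul_mul_assoc]

/-- Pullback of forms along a map of pointed simplicial sets. -/
def aPLMap {S T : SSet.{u}} (g : S ⟶ T) (s : S.obj (op (SimplexCategory.mk 0))) (t : T.obj (op (SimplexCategory.mk 0)))
    (h : g.app _ s = t) : (aPL T t).Hom (aPL S s) where
  f k :=
    { toFun := fun (α : aPLX T t k) => (⟨fun n σ => α.1 n (g.app _ σ),
        fun n σ => α.2.1 n _,
        fun m n f σ => by dsimp only; rw [← α.2.2.1, NatTrans.naturality_apply],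
        fun n f => by dsimp only; rw [NatTrans.naturality_apply, h, α.2.2.2]⟩ : aPLX S s k)
      map_add' := fun α β => rfl
      map_smul' := fun c α => rfl }
  f_d := fun _ _ => rfl
  f_mul := fun _ _ _ => rfl

end SSet

/-- The vertex of the singular simplicial set given by a point of the space. -/
def singularVertex (X : TopCat.{u}) (x : X) : (TopCat.toSSet.obj X).obj (op (SimplexCategory.mk 0)) :=
  (X.toSSetObjEquiv (op (SimplexCategory.mk 0))).symm (ContinuousMap.const _ x)

theorem singularVertex_map {X Y : TopCat.{u}} (f : X ⟶ Y) (x : X) :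
    (TopCat.toSSet.map f).app _ (singularVertex X x) = singularVertex Y (f x) := rfl

/-- The nonunital commutative differential graded algebra `A_PL(X)` of (reduced) polynomial
differential forms on a pointed space `X`: the forms on the singular simplicial set of `X`, with
rational coefficients, that restrict to zero on the base point. -/
def reducedAPL (X : Type u) [TopologicalSpace X] (x : X) : CDGA.{u} :=
  SSet.aPL (TopCat.toSSet.obj (TopCat.of X)) (singularVertex (TopCat.of X) x)

/-- Pullback of polynomial forms along a base point preserving continuous map. -/
def reducedAPLMap {X Y : Type u} [TopologicalSpace X] [TopologicalSpace Y] (f : C(X, Y)) (x : X)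
    (y : Y) (h : f x = y) : (reducedAPL Y y).Hom (reducedAPL X x) :=
  SSet.aPLMap (TopCat.toSSet.map (TopCat.ofHom f)) _ _ (by
    rw [singularVertex_map]
    exact congrArg _ h)

/-! ### Free graded Lie algebras -/

/-- `IsLieWord V n x`: the element `x` of the tensor algebra on `⨁ V i` is an iterated graded
commutator of homogeneous elements of `V`, of total degree `n`. -/
inductive IsLieWord (V : ℤ → Type u) [∀ i, AddCommGroup (V i)] [∀ i, Module ℚ (V i)] :
    ℤ → TensorAlgebra ℚ (⨁ i, V i) → Prop
  | of {i : ℤ} (v : V i) : IsLieWord V i (TensorAlgebra.ι ℚ (DirectSum.lof ℚ ℤ V i v))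
  | br {i j : ℤ} {x y : TensorAlgebra ℚ (⨁ i, V i)} :
      IsLieWord V i x → IsLieWord V j y → IsLieWord V (i + j) (x * y - koszul (i * j) • (y * x))

section FreeLie

variable (V : ℤ → Type u) [∀ i, AddCommGroup (V i)] [∀ i, Module ℚ (V i)]
variable (W : ℤ → Type v) [∀ i, AddCommGroup (W i)] [∀ i, Module ℚ (W i)]

/-- The degree `n` part of the free graded Lie algebra. -/
def freeLieX (n : ℤ) : Submodule ℚ (TensorAlgebra ℚ (⨁ i, V i)) :=
  Submodule.span ℚ {x | IsLieWord V n x}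

variable {V} in
theorem commutator_mem_freeLieX {i j k : ℤ} (h : i + j = k) {x y : TensorAlgebra ℚ (⨁ i, V i)}
    (hx : x ∈ freeLieX V i) (hy : y ∈ freeLieX V j) :
    x * y - koszul (i * j) • (y * x) ∈ freeLieX V k := by
  subst h
  induction hx using Submodule.span_induction with
  | mem x hx =>
    induction hy using Submodule.span_induction with
    | mem y hy => exact Submodule.subset_span (IsLieWord.br hx hy)
    | zero => simp
    | add y y' _ _ h h' =>
      have := add_mem h h'
      convert this using 1
      rw [mul_add, add_mul, smul_add]; abel
    | smul c y _ h =>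
      have := Submodule.smul_mem _ c h
      convert this using 1
      rw [mul_smul_comm, smul_mul_assoc, smul_sub, smul_comm]
  | zero => simp
  | add x x' _ _ h h' =>
    have := add_mem h h'
    convert this using 1
    rw [mul_add, add_mul, smul_add]; abel
  | smul c x _ h =>
    have := Submodule.smul_mem _ c h
    convert this using 1
    rw [mul_smul_comm, smul_mul_assoc, smul_sub, smul_comm]

/-- The free graded Lie algebra on the graded vector space `V`, with zero differential: the graded
Lie subalgebra generated by `V` in the tensor algebra on `V` with the graded commutator. -/
def freeLie : DGLie.{u} where
  X n := ↥(freeLieX V n)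
  d := fun _ => 0
  d_d := fun _ _ _ => rfl
  br := fun {i j k} h => LinearMap.mk₂ ℚ
    (fun x y => ⟨x.1 * y.1 - koszul (i * j) • (y.1 * x.1), commutator_mem_freeLieX h x.2 y.2⟩)
    (fun x x' y => Subtype.ext (by simp [mul_add, add_mul]; abel))
    (fun c x y => Subtype.ext (by simp [smul_sub, smul_comm c]))
    (fun x y y' => Subtype.ext (by simp [mul_add, add_mul]; abel))
    (fun c x y => Subtype.ext (by simp [smul_sub, smul_comm c]))
  br_antisymm := fun {i j k} h h' x y => Subtype.ext (by
    simp only [LinearMap.mk₂_apply, NegMemClass.coe_neg, Submodule.coe_smul]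
    rw [smul_sub, smul_smul, mul_comm j i, koszul_mul_self, one_smul]
    abel)
  jacobi := fun {i j k ij jk ik n} hij hjk hik h₁ h₂ h₃ x y z => Subtype.ext (by
    subst hij hjk hik
    simp only [LinearMap.mk₂_apply, Submodule.coe_add, Submodule.coe_smul]
    have e1 : koszul (i * (j + k)) = koszul (i * j) * koszul (i * k) := by
      rw [← koszul_add]; congr 1; ring
    have e2 : koszul ((i + j) * k) = koszul (i * k) * koszul (j * k) := by
      rw [← koszul_add]; congr 1; ring
    have e3 : koszul (j * (i + k)) = koszul (i * j) * koszul (j * k) := by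
      rw [← koszul_add]; congr 1; ring
    rw [e1, e2, e3]
    simp only [mul_sub, sub_mul, smul_sub, mul_smul_comm, smul_mul_assoc, smul_smul, mul_assoc]
    have := koszul_mul_self (i * j)
    generalize koszul (i * j) = a at *
    generalize koszul (i * k) = b at *
    generalize koszul (j * k) = c at *
    rw [show a * (a * c) = c by rw [← mul_assoc, this, one_mul],
      show a * (a * (c * b)) = c * b by rw [← mul_assoc, this, one_mul]]
    module)
  d_br := fun _ _ _ _ _ _ _ _ => by simp only [LinearMap.zero_apply, map_zero, smul_zero, add_zero]

variable {V W}

/-- The map of tensor algebras induced by a map of graded vector spaces. -/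
def gradedTensorMap (f : ∀ i, V i →ₗ[ℚ] W i) :
    TensorAlgebra ℚ (⨁ i, V i) →ₐ[ℚ] TensorAlgebra ℚ (⨁ i, W i) :=
  TensorAlgebra.lift ℚ ((TensorAlgebra.ι ℚ).comp
    (DirectSum.toModule ℚ ℤ _ fun i => (DirectSum.lof ℚ ℤ W i).comp (f i)))

theorem gradedTensorMap_mem (f : ∀ i, V i →ₗ[ℚ] W i) {n : ℤ} {x : TensorAlgebra ℚ (⨁ i, V i)}
    (hx : x ∈ freeLieX V n) : gradedTensorMap f x ∈ freeLieX W n := by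
  induction hx using Submodule.span_induction with
  | mem x hx =>
    refine Submodule.subset_span ?_
    change IsLieWord W n _
    induction hx with
    | of v => simpa [gradedTensorMap] using IsLieWord.of (f _ v)
    | br _ _ hx hy => simpa using IsLieWord.br hx hy
  | zero => simp
  | add x y _ _ hx hy => rw [map_add]; exact add_mem hx hy
  | smul c x _ hx => rw [map_smul]; exact Submodule.smul_mem _ c hx

/-- Functoriality of the free graded Lie algebra. -/
def freeLieMap (f : ∀ i, V i →ₗ[ℚ] W i) : (freeLie V).Hom (freeLie W) where
  f n := (gradedTensorMap f).toLinearMap.restrict (p := freeLieX V n) (q := freeLieX W n)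
    fun _ hx => gradedTensorMap_mem f hx
  f_d := fun _ _ => map_zero _
  f_br := fun {i j k} e x y => Subtype.ext (by
    change gradedTensorMap f (x.1 * y.1 - koszul (i * j) • (y.1 * x.1)) =
      gradedTensorMap f x.1 * gradedTensorMap f y.1 -
        koszul (i * j) • (gradedTensorMap f y.1 * gradedTensorMap f x.1)
    simp)

end FreeLie

/-! ### The representations `ℚ` and `ℚ^sgn` of the group `C₂ = {1, -1}` and their shifts -/

/-- The sign representation of `C₂ = {1, -1}` on `ℚ`. -/
def signRep : Representation ℚ ℤˣ ℚ where
  toFun ε := ((ε : ℤ) : ℚ) • LinearMap.id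
  map_one' := by simp; rfl
  map_mul' ε δ := by ext; simp [mul_comm]

/-- The graded vector space `ℚ[r]`, with `ℚ` in degree `r` and zero in all other degrees. -/
abbrev shiftedLine (r i : ℤ) : Submodule ℚ ℚ := if i = r then ⊤ else ⊥

/-- The endomorphism of `ℚ[r]` given by an endomorphism of `ℚ`. -/
def shiftedLineMap (r : ℤ) (f : ℚ →ₗ[ℚ] ℚ) (i : ℤ) : shiftedLine r i →ₗ[ℚ] shiftedLine r i :=
  f.restrict fun x hx => by
    by_cases h : i = r
    · simp [shiftedLine, h]
    · simp only [shiftedLine, h, if_false, Submodule.mem_bot] at hx ⊢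
      rw [hx, map_zero]

/-- The free graded Lie algebra on `ℚ[r]`. -/
def freeLieLine (r : ℤ) : DGLie.{0} := freeLie fun i => shiftedLine r i

/-! ### The orientation cover -/

section Orientation

variable (n : ℕ) (M : Type u) [TopologicalSpace M] [ChartedSpace (EuclideanSpace ℝ (Fin n)) M]
  [IsManifold (𝓡 n) ∞ M]

/-- The sign of a nonzero real number. -/
def realSign (x : ℝ) : ℤˣ := if 0 < x then 1 else -1

theorem realSign_mul {x y : ℝ} (hx : x ≠ 0) (hy : y ≠ 0) :
    realSign (x * y) = realSign x * realSign y := by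
  unfold realSign
  rcases lt_or_gt_of_ne hx with h | h <;> rcases lt_or_gt_of_ne hy with h' | h' <;>
    simp [h, h', h.le, h'.le, not_lt.2, mul_pos_of_neg_of_neg,
      mul_nonpos_of_nonneg_of_nonpos, mul_nonpos_of_nonpos_of_nonneg]

theorem continuousAt_realSign {x : ℝ} (hx : x ≠ 0) : ContinuousAt realSign x := by
  rcases lt_or_gt_of_ne hx with h | h
  · refine (continuousAt_const (y := (-1 : ℤˣ))).congr ?_
    filter_upwards [eventually_lt_nhds h] with y hy
    simp [realSign, not_lt.2 hy.le]
  · refine (continuousAt_const (y := (1 : ℤˣ))).congr ?_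
    filter_upwards [eventually_gt_nhds h] with y hy
    simp [realSign, hy]

/-- The Jacobian determinant at `x` of the transition from the chart `i` to the chart `j`. -/
def jacobian (i j : atlas (EuclideanSpace ℝ (Fin n)) M) (x : M) : ℝ :=
  haveI : IsManifold (𝓡 n) 1 M := IsManifold.of_le (n := ∞) (by simp)
  ((tangentBundleCore (𝓡 n) M).coordChange i j x).det

theorem jacobian_mul (i j k : atlas (EuclideanSpace ℝ (Fin n)) M) {x : M} (hi : x ∈ i.1.source)
    (hj : x ∈ j.1.source) (hk : x ∈ k.1.source) :
    jacobian n M i j x * jacobian n M j k x = jacobian n M i k x := by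
  have : IsManifold (𝓡 n) 1 M := IsManifold.of_le (n := ∞) (by simp)
  have h : (tangentBundleCore (𝓡 n) M).coordChange i k x =
      ((tangentBundleCore (𝓡 n) M).coordChange j k x).comp
        ((tangentBundleCore (𝓡 n) M).coordChange i j x) :=
    ContinuousLinearMap.ext fun v =>
      ((tangentBundleCore (𝓡 n) M).coordChange_comp i j k x ⟨⟨hi, hj⟩, hk⟩ v).symm
  rw [jacobian, jacobian, jacobian, h, mul_comm]
  exact (LinearMap.det_comp _ _).symm

theorem jacobian_self (i : atlas (EuclideanSpace ℝ (Fin n)) M) {x : M} (hi : x ∈ i.1.source) :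
    jacobian n M i i x = 1 := by
  have : IsManifold (𝓡 n) 1 M := IsManifold.of_le (n := ∞) (by simp)
  have h : (tangentBundleCore (𝓡 n) M).coordChange i i x = ContinuousLinearMap.id ℝ _ :=
    ContinuousLinearMap.ext fun v => (tangentBundleCore (𝓡 n) M).coordChange_self i x hi v
  rw [jacobian, h]
  exact LinearMap.det_id

theorem jacobian_ne_zero (i j : atlas (EuclideanSpace ℝ (Fin n)) M) {x : M}
    (hi : x ∈ i.1.source) (hj : x ∈ j.1.source) : jacobian n M i j x ≠ 0 := by
  intro h
  have := jacobian_mul n M i j i hi hj hi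
  rw [h, zero_mul, jacobian_self n M i hi] at this
  exact zero_ne_one this

/-- The orientation cover of a smooth manifold `M`, as the double cover with fibre `{1, -1}` whose
transition functions are the signs of the Jacobian determinants of the coordinate changes. -/
def orientationCore :
    FiberBundleCore (atlas (EuclideanSpace ℝ (Fin n)) M) M ℤˣ := by
  haveI : IsManifold (𝓡 n) 1 M := IsManifold.of_le (n := ∞) (by simp)
  exact
  { baseSet := fun i => i.1.source
    isOpen_baseSet := fun i => i.1.open_source
    indexAt := achart (EuclideanSpace ℝ (Fin n))
    mem_baseSet_at := mem_chart_source (EuclideanSpace ℝ (Fin n))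
    coordChange := fun i j x s => realSign (jacobian n M i j x) * s
    coordChange_self := fun i x hx s => by
      have := jacobian_self n M i hx
      simp [this, realSign]
    continuousOn_coordChange := fun i j => by
      rintro ⟨x, s⟩ ⟨⟨hi, hj⟩, -⟩
      have h0 : jacobian n M i j x ≠ 0 := jacobian_ne_zero n M i j hi hj
      have h1 : ContinuousWithinAt (jacobian n M i j) (i.1.source ∩ j.1.source) x :=
        ContinuousLinearMap.continuous_det.continuousAt.comp_continuousWithinAt
          ((tangentBundleCore (𝓡 n) M).continuousOn_coordChange i j x ⟨hi, hj⟩)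
      have h2 : ContinuousWithinAt (fun y => realSign (jacobian n M i j y))
          (i.1.source ∩ j.1.source) x :=
        (continuousAt_realSign h0).comp_continuousWithinAt h1
      have h3 : ContinuousWithinAt (fun p : M × ℤˣ => realSign (jacobian n M i j p.1))
          ((i.1.source ∩ j.1.source) ×ˢ Set.univ) (x, s) :=
        ContinuousWithinAt.comp (f := Prod.fst) (x := (x, s)) h2 continuousWithinAt_fst
          (fun p hp => hp.1)
      exact h3.mul continuousWithinAt_snd
    coordChange_comp := fun i j k x hx s => by
      rw [← mul_assoc, ← jacobian_mul n M i j k hx.1.1 hx.1.2 hx.2, realSign_mul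
        (jacobian_ne_zero n M i j hx.1.1 hx.1.2) (jacobian_ne_zero n M j k hx.1.2 hx.2),
        mul_comm (realSign _)] }

/-- The total space of the orientation cover: a point is a point of `M` together with a local
orientation, recorded by its sign relative to the preferred chart at the point. -/
abbrev OrientationCover : Type u := (orientationCore n M).TotalSpace

/-- The deck transformation of the orientation cover given by an element of `C₂ = {1, -1}`: the
element `-1` reverses the local orientation. -/
def deckFun (ε : ℤˣ) (p : OrientationCover n M) : OrientationCover n M :=
  ⟨p.1, ε * (show ℤˣ from p.2)⟩

theorem continuous_deckFun (ε : ℤˣ) : Continuous (deckFun n M ε) := by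
  rw [continuous_iff_continuousAt]
  intro p
  have h := (FiberBundle.continuousAt_totalSpace ℤˣ (E := (orientationCore n M).Fiber)
    (x₀ := p) (fun q => q)).1 continuousAt_id
  refine (FiberBundle.continuousAt_totalSpace ℤˣ _).2 ⟨h.1, ?_⟩
  refine (h.2.const_mul ε).congr (Filter.Eventually.of_forall fun q => ?_)
  exact mul_left_comm ε (realSign _) _

/-- The action of `C₂ = {1, -1}` on the orientation cover by deck transformations. -/
def deck (ε : ℤˣ) : OrientationCover n M ≃ₜ OrientationCover n M where
  toFun := deckFun n M ε
  invFun := deckFun n M ε⁻¹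
  left_inv p := congrArg (Bundle.TotalSpace.mk p.1) (inv_mul_cancel_left ε _)
  right_inv p := congrArg (Bundle.TotalSpace.mk p.1) (mul_inv_cancel_left ε _)
  continuous_toFun := continuous_deckFun n M ε
  continuous_invFun := continuous_deckFun n M ε⁻¹

/-- The action of `C₂` on the one-point compactification of the orientation cover. -/
def deckPlus (ε : ℤˣ) : C(OnePoint (OrientationCover n M), OnePoint (OrientationCover n M)) :=
  ⟨(deck n M ε).onePointCongr, (deck n M ε).onePointCongr.continuous⟩

/-- The differential graded Lie algebra `A_PL(M̃⁺) ⊗ L(K[r])`, where `M̃⁺` is the one-point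
compactification of the orientation cover, pointed at infinity.  (It depends only on the vector
space underlying the representation `K`.) -/
def formsLie (r : ℤ) : DGLie.{u} :=
  CDGA.tensorLie (reducedAPL (OnePoint (OrientationCover n M)) OnePoint.infty) (freeLieLine r)

/-- The diagonal action of `C₂` on `A_PL(M̃⁺) ⊗ L(K[r])`: by pullback along deck transformations on
the forms, and through the representation `K` on the free Lie algebra. -/
def formsLieAction (K : Representation ℚ ℤˣ ℚ) (r : ℤ) (ε : ℤˣ) :
    (formsLie n M r).Hom (formsLie n M r) :=
  CDGA.tensorLieMap (reducedAPLMap (deckPlus n M ε⁻¹) _ _ rfl)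
    (freeLieMap (shiftedLineMap r (K ε)))

/-- The differential graded Lie algebra `(A_PL(M̃⁺) ⊗ L(K[r]))^{C₂}`. -/
def equivariantMapLie (K : Representation ℚ ℤˣ ℚ) (r : ℤ) : DGLie.{u} :=
  (formsLie n M r).invariants (formsLieAction n M K r)

end Orientation

end

/-! The free graded Lie algebra on one generator `x` of degree `r` is tiny. If `r` is even, `[x, x]
= 0` and the algebra is an abelian line. If `r` is odd, it is spanned by `x` and `x²`, in degrees
`r` and `2r`, and every bracket of length three vanishes. So for any commutative algebra `A`, the
part of `A ⊗ L(ℚ[r])` whose Lie factor has degree `2r` is central and contains all brackets. Since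
`L(ℚ[r])` has zero differential, the projection `π` onto this part is a chain map. An action on the
two factors preserves the degree of each, hence commutes with `π`, and `π` restricts to the
invariants (`CentralProjection.invariants`).

It remains to see that a differential graded Lie algebra `g` with such a projection is formal
(`CentralProjection.isFormal`). As a complex, `g = ker π ⊕ im π`. Choose a space `S` of cycles in
`ker π` representing the homology of `ker π`. Then `S ⊕ im π` is a sub Lie algebra, because all
brackets lie in `im π`, and its inclusion into `g` is a quasi-isomorphism. A linear retraction `ρ`
of `g` onto its cycles that commutes with `π` gives a map `w ↦ [ρ w]` from `S ⊕ im π` to `H(g)`. It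
preserves brackets because these see only the components in `S`, which `ρ` fixes. It is again a
quasi-isomorphism, so `g ← S ⊕ im π → H(g)` is the required zig-zag. Finally, formality is invariant
under equivalence. -/

open scoped TensorProduct DirectSum Manifold ContDiff

noncomputable section

/-! ### Homology classes in terms of cycles and boundaries. -/

namespace DGVect

theorem cls_eq_zero_iff (V : DGVect.{u}) {i : ℤ} (x : V.cycles i) :
    V.cls x = 0 ↔ x.1 ∈ V.boundaries i :=
  Submodule.Quotient.mk_eq_zero _

theorem cls_eq_iff (V : DGVect.{u}) {i : ℤ} (x y : V.cycles i) :
    V.cls x = V.cls y ↔ x.1 - y.1 ∈ V.boundaries i :=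
  Submodule.Quotient.eq _

theorem cls_surjective (V : DGVect.{u}) {i : ℤ} (x : V.H i) : ∃ y, V.cls y = x :=
  Submodule.Quotient.mk_surjective _ x

theorem boundaries_le_cycles (V : DGVect.{u}) (i : ℤ) : V.boundaries i ≤ V.cycles i := by
  intro x hx
  obtain ⟨y, rfl⟩ := (V.mem_boundaries rfl x).1 hx
  exact V.d_d _ _ y

end DGVect

/-! ### Quasi-isomorphisms, functoriality of homology, invariance of formality. -/

namespace DGLie

theorem Hom.map_cycles {g : DGLie.{u}} {h : DGLie.{v}} (φ : Hom g h) {i : ℤ} {x : g.X i}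
    (hx : x ∈ g.cycles i) : φ.f i x ∈ h.cycles i := by
  rw [h.mem_cycles (sub_add_cancel i 1), ← φ.f_d, (g.mem_cycles _ x).1 hx, map_zero]

theorem Hom.homologyMap_cls {g : DGLie.{u}} {h : DGLie.{v}} (φ : Hom g h) {i : ℤ}
    (x : g.cycles i) : φ.homologyMap i (g.cls x) = h.cls ⟨φ.f i x.1, φ.map_cycles x.2⟩ := rfl

/-- Quasi-isomorphisms in terms of cycles and boundaries. -/
theorem Hom.isQuasiIso_iff {g : DGLie.{u}} {h : DGLie.{v}} (φ : Hom g h) :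
    φ.IsQuasiIso ↔ ∀ i, (∀ x ∈ g.cycles i, φ.f i x ∈ h.boundaries i → x ∈ g.boundaries i) ∧
      ∀ y ∈ h.cycles i, ∃ x ∈ g.cycles i, φ.f i x - y ∈ h.boundaries i := by
  refine forall_congr' fun i => and_congr ?_ ?_
  · rw [injective_iff_map_eq_zero]
    constructor
    · intro H x hx hb
      refine (g.cls_eq_zero_iff ⟨x, hx⟩).1 (H _ ?_)
      rw [homologyMap_cls, DGVect.cls_eq_zero_iff]
      exact hb
    · intro H a ha
      obtain ⟨x, rfl⟩ := g.cls_surjective a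
      rw [homologyMap_cls, DGVect.cls_eq_zero_iff] at ha
      exact (g.cls_eq_zero_iff x).2 (H _ x.2 ha)
  · constructor
    · intro H y hy
      obtain ⟨a, ha⟩ := H (h.cls ⟨y, hy⟩)
      obtain ⟨x, rfl⟩ := g.cls_surjective a
      rw [homologyMap_cls, DGVect.cls_eq_iff] at ha
      exact ⟨x.1, x.2, ha⟩
    · intro H b
      obtain ⟨y, rfl⟩ := h.cls_surjective b
      obtain ⟨x, hx, hxy⟩ := H y.1 y.2
      refine ⟨g.cls ⟨x, hx⟩, ?_⟩
      rw [homologyMap_cls, DGVect.cls_eq_iff]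
      exact hxy

theorem mem_homology_cycles (g : DGLie.{u}) {i : ℤ} (x : g.homology.X i) :
    x ∈ g.homology.cycles i :=
  (g.homology.mem_cycles (sub_add_cancel i 1) x).2 rfl

theorem mem_homology_boundaries (g : DGLie.{u}) {i : ℤ} (x : g.homology.X i) :
    x ∈ g.homology.boundaries i ↔ x = 0 := by
  rw [DGVect.mem_boundaries _ rfl]
  exact ⟨fun ⟨_, h⟩ => h.symm, fun h => ⟨0, h.symm⟩⟩

/-- Functoriality of homology. -/
def Hom.homologyHom {g : DGLie.{u}} {h : DGLie.{v}} (φ : Hom g h) :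
    Hom g.homology h.homology where
  f := φ.homologyMap
  f_d := fun _ _ => map_zero _
  f_br := by
    intro i j k e x y
    obtain ⟨x, rfl⟩ := g.cls_surjective x
    obtain ⟨y, rfl⟩ := g.cls_surjective y
    exact congrArg h.cls (Subtype.ext (φ.f_br e x.1 y.1))

/-- In a homology algebra every element is a cycle and only `0` is a boundary, so the criterion for
a quasi-isomorphism reduces to bijectivity of `φ.homologyMap`. -/
theorem Hom.IsQuasiIso.homologyHom {g : DGLie.{u}} {h : DGLie.{v}} {φ : Hom g h}
    (hφ : φ.IsQuasiIso) : φ.homologyHom.IsQuasiIso := by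
  rw [Hom.isQuasiIso_iff]
  intro i
  simp only [mem_homology_boundaries]
  refine ⟨fun x _ hx => (hφ i).1 (hx.trans (map_zero _).symm), fun y _ => ?_⟩
  obtain ⟨x, hx⟩ := (hφ i).2 y
  exact ⟨x, g.mem_homology_cycles x, sub_eq_zero.2 hx⟩

/-- Each arrow of the zig-zag induces a quasi-isomorphism between the homology algebras, in the same
direction. -/
theorem Equivalent.homology {g h : DGLie.{u}} (e : Equivalent g h) :
    Equivalent g.homology h.homology := by
  induction e with
  | rel _ _ H =>
    obtain ⟨φ, hφ⟩ := H
    exact .rel _ _ ⟨φ.homologyHom, hφ.homologyHom⟩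
  | refl _ => exact .refl _
  | symm _ _ _ ih => exact .symm _ _ ih
  | trans _ _ _ _ _ ih ih' => exact .trans _ _ _ ih ih'

/-- The chain is `g ∼ h ∼ H(h) ∼ H(g)`, where the last link is the given zig-zag after passing to
homology. -/
theorem IsFormal.of_equivalent {g h : DGLie.{u}} (hh : IsFormal h) (e : Equivalent g h) :
    IsFormal g :=
  .trans _ _ _ (.trans _ _ _ e hh) (.symm _ _ e.homology)

/-! ### Central projections and the model `S ⊕ im π`. -/

/-- A graded subspace closed under the differential and the bracket. -/
def sub (g : DGLie.{u}) (W : ∀ i, Submodule ℚ (g.X i))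
    (hd : ∀ {i j : ℤ} (e : j + 1 = i) (x : g.X i), x ∈ W i → g.d e x ∈ W j)
    (hbr : ∀ {i j k : ℤ} (e : i + j = k) (x : g.X i) (y : g.X j),
      x ∈ W i → y ∈ W j → g.br e x y ∈ W k) : DGLie.{u} where
  X i := ↥(W i)
  d := fun e => (g.d e).restrict (hd e)
  d_d := fun h h' x => Subtype.ext (g.d_d h h' x.1)
  br := fun e => LinearMap.mk₂ ℚ (fun x y => ⟨g.br e x.1 y.1, hbr e _ _ x.2 y.2⟩)
    (fun _ _ _ => Subtype.ext (by simp)) (fun _ _ _ => Subtype.ext (by simp))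
    (fun _ _ _ => Subtype.ext (by simp)) (fun _ _ _ => Subtype.ext (by simp))
  br_antisymm := fun h h' x y => Subtype.ext (g.br_antisymm h h' x.1 y.1)
  jacobi := fun hij hjk hik h₁ h₂ h₃ x y z =>
    Subtype.ext (g.jacobi hij hjk hik h₁ h₂ h₃ x.1 y.1 z.1)
  d_br := fun h hi hj hk h₁ h₂ x y => Subtype.ext (g.d_br h hi hj hk h₁ h₂ x.1 y.1)

/-- A central projection: an idempotent chain map whose image is central and contains all
brackets.  It exhibits `g` as the direct sum of the complexes `ker π` and `im π`, with
`[ker π, ker π] ⊆ im π`. -/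
structure CentralProjection (g : DGLie.{u}) where
  π : ∀ i, g.X i →ₗ[ℚ] g.X i
  idem : ∀ {i : ℤ} (x : g.X i), π i (π i x) = π i x
  comm_d : ∀ {i j : ℤ} (e : j + 1 = i) (x : g.X i), π j (g.d e x) = g.d e (π i x)
  br_mem : ∀ {i j k : ℤ} (e : i + j = k) (x : g.X i) (y : g.X j), π k (g.br e x y) = g.br e x y
  central : ∀ {i j k : ℤ} (e : i + j = k) (x : g.X i) (y : g.X j), g.br e (π i x) y = 0

namespace CentralProjection

variable {g : DGLie.{u}} (P : CentralProjection g)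

theorem central_right {i j k : ℤ} (e : i + j = k) (x : g.X i) (y : g.X j) :
    g.br e x (P.π j y) = 0 := by
  rw [g.br_antisymm e (by omega), P.central, smul_zero, neg_zero]

/-- Changing either argument by an element of `im π` does not affect a bracket: brackets depend only
on the components in `ker π`. -/
theorem br_sub_sub {i j k : ℤ} (e : i + j = k) (x : g.X i) (y : g.X j) :
    g.br e (x - P.π i x) (y - P.π j y) = g.br e x y := by
  simp [P.central, P.central_right]

theorem π_mem_cycles {i : ℤ} {x : g.X i} (hx : x ∈ g.cycles i) : P.π i x ∈ g.cycles i := by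
  rw [g.mem_cycles (sub_add_cancel i 1)] at hx ⊢
  rw [← P.comm_d, hx, map_zero]

/-- The quotient of the two intersections is the homology of the complex `ker π`: if `d y` lies in
`ker π`, then `d y = d (y - π y)`, because `π` is a chain map. -/
theorem exists_complement (i : ℤ) : ∃ S : Submodule ℚ (g.X i),
    Disjoint (g.boundaries i ⊓ LinearMap.ker (P.π i)) S ∧
      g.boundaries i ⊓ LinearMap.ker (P.π i) ⊔ S = g.cycles i ⊓ LinearMap.ker (P.π i) :=
  IsModularLattice.exists_disjoint_and_sup_eq (inf_le_inf_right _ (g.boundaries_le_cycles i))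

/-- A choice of representing cycles for the homology of `ker π`. -/
def reps (i : ℤ) : Submodule ℚ (g.X i) := (P.exists_complement i).choose

theorem reps_le (i : ℤ) : P.reps i ≤ g.cycles i ⊓ LinearMap.ker (P.π i) :=
  le_sup_right.trans_eq (P.exists_complement i).choose_spec.2

theorem eq_zero_of_mem_reps {i : ℤ} {x : g.X i} (hx : x ∈ P.reps i) (hb : x ∈ g.boundaries i) :
    x = 0 :=
  Submodule.disjoint_def.1 (P.exists_complement i).choose_spec.1 x ⟨hb, (P.reps_le i hx).2⟩ hx

theorem exists_reps {i : ℤ} {x : g.X i} (hx : x ∈ g.cycles i) (hπ : P.π i x = 0) :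
    ∃ s ∈ P.reps i, s - x ∈ g.boundaries i := by
  have : x ∈ g.cycles i ⊓ LinearMap.ker (P.π i) := ⟨hx, hπ⟩
  rw [← (P.exists_complement i).choose_spec.2] at this
  obtain ⟨b, hb, s, hs, rfl⟩ := Submodule.mem_sup.1 this
  exact ⟨s, hs, by simpa using hb.1⟩

/-- The subcomplex of `g` spanned by `im π` and the representing cycles for `ker π`. -/
def modelX (i : ℤ) : Submodule ℚ (g.X i) := (P.reps i).comap (LinearMap.id - P.π i)

theorem mem_modelX {i : ℤ} {x : g.X i} : x ∈ P.modelX i ↔ x - P.π i x ∈ P.reps i := Iff.rfl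

/-- All of `im π` lies in the model. Both closure properties of the model follow from this, since
differentials of its elements and all brackets land in `im π`. -/
theorem mem_modelX_of_π_eq {i : ℤ} {x : g.X i} (h : P.π i x = x) : x ∈ P.modelX i := by
  rw [mem_modelX, h, sub_self]
  exact zero_mem _

/-- The sub Lie algebra `modelX`. -/
def model : DGLie.{u} :=
  g.sub P.modelX
    -- The component `x - π x` is a representing cycle, so `d x = d (π x) = π (d x)`.
    (fun {i j} e x hx => P.mem_modelX_of_π_eq (by
      have := (g.mem_cycles e _).1 (P.reps_le i hx).1
      rw [LinearMap.sub_apply, LinearMap.id_apply, map_sub, sub_eq_zero] at this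
      rw [P.comm_d, this]))
    (fun e x y _ _ => P.mem_modelX_of_π_eq (P.br_mem e x y))

/-- The inclusion of `model`. -/
def incl : P.model.Hom g where
  f i := (P.modelX i).subtype
  f_d := fun _ _ => rfl
  f_br := fun _ _ _ => rfl

/-- The model keeps the summand `im π` and replaces the summand `ker π` by cycles representing its
homology. -/
theorem incl_isQuasiIso : P.incl.IsQuasiIso := by
  rw [Hom.isQuasiIso_iff]
  intro i
  constructor
  · intro w _ hb
    change w.1 ∈ _ at hb
    obtain ⟨y, hy⟩ := (g.mem_boundaries rfl _).1 hb
    -- If `w = d y`, the `ker π` component of `w` is `d (y - π y)`: a representative that bounds,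
    -- hence zero.
    have h0 : w.1 - P.π i w.1 = 0 := by
      refine P.eq_zero_of_mem_reps w.2 ((g.mem_boundaries rfl _).2 ⟨y - P.π _ y, ?_⟩)
      rw [map_sub, ← P.comm_d, hy]
    -- Now `w = π w = d (π y)`, and the primitive `π y` lies in the model although `y` need not.
    refine (P.model.mem_boundaries rfl _).2
      ⟨⟨P.π _ y, P.mem_modelX_of_π_eq (P.idem y)⟩, Subtype.ext ?_⟩
    change g.d rfl (P.π _ y) = w.1
    rw [← P.comm_d, hy, ← sub_eq_zero.1 h0]
  · intro x hx
    have hc : x - P.π i x ∈ g.cycles i := sub_mem hx (P.π_mem_cycles hx)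
    obtain ⟨s, hs, hb⟩ := P.exists_reps hc (by rw [map_sub, P.idem, sub_self])
    have hsk : P.π i s = 0 := (P.reps_le i hs).2
    -- The cycle `x` is moved into the model by keeping `π x` and replacing `x - π x` by its
    -- homologous representative `s`.
    have hw : P.π i x + s ∈ P.modelX i := by
      rw [mem_modelX, map_add, P.idem, hsk]
      simpa using hs
    refine ⟨⟨P.π i x + s, hw⟩, ?_, ?_⟩
    · refine (P.model.mem_cycles (sub_add_cancel i 1) _).2 (Subtype.ext ?_)
      exact (g.mem_cycles (sub_add_cancel i 1) _).1
        (add_mem (P.π_mem_cycles hx) (P.reps_le i hs).1)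
    · change P.π i x + s - x ∈ _
      convert hb using 1
      abel

/-! ### The projection from the model to homology. -/

/-- Any linear retraction onto the cycles becomes compatible with `π` once its off-diagonal blocks
for `ker π ⊕ im π` are discarded. -/
theorem exists_retraction (i : ℤ) : ∃ ρ : g.X i →ₗ[ℚ] g.cycles i,
    (∀ x : g.cycles i, ρ x = x) ∧ ∀ x, (ρ (P.π i x) : g.X i) = P.π i (ρ x) := by
  obtain ⟨σ, hσ⟩ := (g.cycles i).subtype.exists_leftInverse_of_injective (by simp)
  have hσ' : ∀ x ∈ g.cycles i, (σ x : g.X i) = x := fun x hx =>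
    congrArg Subtype.val (LinearMap.congr_fun hσ ⟨x, hx⟩)
  let τ : g.cycles i →ₗ[ℚ] g.cycles i := (P.π i).restrict fun x hx => P.π_mem_cycles hx
  have hτ (x) : (τ x : g.X i) = P.π i x := rfl
  -- The block-diagonal part of `σ`, with `τ` the restriction of `π` to cycles. On a cycle `x` it
  -- gives `π x + (x - π x) = x`. Applying it after `π`, or `π` after it, leaves only the block `τ σ
  -- π`.
  refine ⟨τ ∘ₗ σ ∘ₗ P.π i + (LinearMap.id - τ) ∘ₗ σ ∘ₗ (LinearMap.id - P.π i), fun x => ?_,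
    fun x => ?_⟩
  · refine Subtype.ext ?_
    simp [hτ, hσ' _ x.2, hσ' _ (P.π_mem_cycles x.2), P.idem]
  · simp [hτ, P.idem]

/-- A projection onto the cycles that commutes with `π`. -/
def retraction (i : ℤ) : g.X i →ₗ[ℚ] g.cycles i := (P.exists_retraction i).choose

theorem retraction_cycle {i : ℤ} (x : g.cycles i) : P.retraction i x = x :=
  (P.exists_retraction i).choose_spec.1 x

theorem retraction_π {i : ℤ} (x : g.X i) :
    (P.retraction i (P.π i x) : g.X i) = P.π i (P.retraction i x) :=
  (P.exists_retraction i).choose_spec.2 x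

theorem retraction_of_mem {i : ℤ} {x : g.X i} (hx : x ∈ g.cycles i) :
    P.retraction i x = ⟨x, hx⟩ :=
  P.retraction_cycle ⟨x, hx⟩

/-- For `x` in the model, `x - π x` is a cycle and so is fixed by the retraction. Hence `x` and its
retraction differ only in the central part `im π`, which brackets ignore. -/
theorem br_retraction {i j k : ℤ} (e : i + j = k) {x : g.X i} {y : g.X j}
    (hx : x ∈ P.modelX i) (hy : y ∈ P.modelX j) :
    g.br e (P.retraction i x) (P.retraction j y) = g.br e x y := by
  rw [← P.br_sub_sub e x y, ← P.br_sub_sub e, ← P.retraction_π, ← P.retraction_π,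
    ← Submodule.coe_sub, ← Submodule.coe_sub, ← map_sub, ← map_sub,
    P.retraction_of_mem (P.reps_le i (P.mem_modelX.1 hx)).1,
    P.retraction_of_mem (P.reps_le j (P.mem_modelX.1 hy)).1]

/-- The projection of `model` to the homology of `g`. -/
def proj : P.model.Hom g.homology where
  f i := (Submodule.mkQ _ ∘ₗ P.retraction i) ∘ₗ (P.modelX i).subtype
  f_d := by
    intro i j e x
    have hb : g.d e x.1 ∈ g.boundaries j := (g.mem_boundaries e _).2 ⟨x.1, rfl⟩
    change g.cls (P.retraction j (g.d e x.1)) = 0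
    -- A boundary is a cycle, so the retraction fixes it and its class vanishes, as the zero
    -- differential of the homology requires.
    rw [P.retraction_of_mem (g.boundaries_le_cycles j hb), DGVect.cls_eq_zero_iff]
    exact hb
  f_br := by
    intro i j k e x y
    change g.cls (P.retraction k (g.br e x.1 y.1)) =
      g.cls (g.cyclesBr e (P.retraction i x.1) (P.retraction j y.1))
    -- Rewritten this way, the bracket is one of cycles, hence a cycle fixed by the retraction.
    rw [← P.br_retraction e x.2 y.2]
    exact congrArg g.cls (P.retraction_cycle (g.cyclesBr e _ _))

/-- On a cycle of the model the retraction does nothing, so `proj` sends it to the class of its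
image under `incl`. Bijectivity on homology is therefore inherited from `incl`. -/
theorem proj_isQuasiIso : P.proj.IsQuasiIso := by
  have key := P.incl.isQuasiIso_iff.1 P.incl_isQuasiIso
  have hproj : ∀ {i : ℤ} (w : P.model.X i) (hw : w ∈ P.model.cycles i),
      P.proj.f i w = g.cls ⟨P.incl.f i w, P.incl.map_cycles hw⟩ := fun w hw =>
    congrArg g.cls (P.retraction_of_mem (P.incl.map_cycles hw))
  rw [Hom.isQuasiIso_iff]
  intro i
  simp only [mem_homology_boundaries]
  constructor
  · intro w hw h0
    exact (key i).1 w hw ((g.cls_eq_zero_iff _).1 ((hproj w hw).symm.trans h0))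
  · intro y _
    obtain ⟨x, rfl⟩ := g.cls_surjective y
    obtain ⟨w, hw, hb⟩ := (key i).2 x.1 x.2
    refine ⟨w, hw, sub_eq_zero.2 ?_⟩
    rw [hproj w hw]
    exact (g.cls_eq_iff _ _).2 hb

theorem isFormal (P : CentralProjection g) : IsFormal g :=
  .trans _ _ _ (.symm _ _ (.rel _ _ ⟨P.incl, P.incl_isQuasiIso⟩))
    (.rel _ _ ⟨P.proj, P.proj_isQuasiIso⟩)

/-- A central projection that commutes with a family of endomorphisms restricts to the
invariants. -/
def invariants {G : Type w} (ρ : G → Hom g g)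
    (hρ : ∀ a i x, P.π i ((ρ a).f i x) = (ρ a).f i (P.π i x)) :
    CentralProjection (g.invariants ρ) where
  π i := (P.π i).restrict (by
    intro x hx
    simp only [Submodule.mem_iInf, LinearMap.mem_eqLocus, LinearMap.id_apply] at hx ⊢
    intro a
    rw [← hρ, hx a])
  idem x := Subtype.ext (P.idem x.1)
  comm_d e x := Subtype.ext (P.comm_d e x.1)
  br_mem e x y := Subtype.ext (P.br_mem e x.1 y.1)
  central e x y := Subtype.ext (P.central e x.1 y.1)

end CentralProjection

end DGLie

/-! ### Central projections on `A ⊗ g` from the grading of `g`. -/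

namespace CDGA

/-- The projection of `A ⊗ g` onto the summands `A ⊗ g_q` with `p q`. -/
def degreeProj (A : CDGA.{u}) (g : DGLie.{v}) (p : ℤ → Prop) [DecidablePred p] (n : ℤ) :
    TensorX A g n →ₗ[ℚ] TensorX A g n :=
  DirectSum.toModule ℚ _ _ fun b =>
    if p b.1.2 then DirectSum.lof ℚ (Bideg n) (fun b => A.X b.1.1 ⊗[ℚ] g.X b.1.2) b else 0

variable {A : CDGA.{u}} {g : DGLie.{v}} (p : ℤ → Prop) [DecidablePred p]

theorem degreeProj_tmul {i j n : ℤ} (e : i + j = n) (a : A.X i) (v : g.X j) :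
    degreeProj A g p n (tmul e a v) = if p j then tmul e a v else 0 := by
  by_cases h : p j <;> simp [degreeProj, tmul, h]

/-- Both `φ` and `ψ` preserve degrees, so `φ ⊗ ψ` respects the summands. This is what lets the
projection pass to invariants of a diagonal action. -/
theorem degreeProj_tensorMapX {B : CDGA.{u}} {h : DGLie.{v}} (φ : A.Hom B) (ψ : g.Hom h) (n : ℤ)
    (x : TensorX A g n) :
    degreeProj B h p n (tensorMapX φ ψ n x) = tensorMapX φ ψ n (degreeProj A g p n x) := by
  induction x using tmul_induction with
  | h0 => simp
  | hadd x y hx hy => simp only [map_add, hx, hy]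
  | ht i j e a v =>
    rw [tensorMapX_tmul, degreeProj_tmul, degreeProj_tmul]
    split_ifs
    · rw [tensorMapX_tmul]
    · rw [map_zero]

/-- If `g` has zero differential, all brackets of `g` are concentrated in the degrees satisfying
`p`, and elements of these degrees are central, then `A ⊗ g` has a central projection. -/
def centralProjection (A : CDGA.{u}) (g : DGLie.{v}) (p : ℤ → Prop) [DecidablePred p]
    (hd : ∀ {i j : ℤ} (e : j + 1 = i) (v : g.X i), g.d e v = 0)
    (hbr : ∀ {i j k : ℤ} (e : i + j = k) (v : g.X i) (w : g.X j), p k ∨ g.br e v w = 0)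
    (hc : ∀ {i j k : ℤ} (e : i + j = k) (v : g.X i) (w : g.X j), p i → g.br e v w = 0) :
    DGLie.CentralProjection (tensorLie A g) where
  π := degreeProj A g p
  idem {n} (x : TensorX A g n) := by
    change degreeProj A g p n (degreeProj A g p n x) = degreeProj A g p n x
    induction x using tmul_induction with
    | h0 => simp
    | hadd x y hx hy => simp only [map_add, hx, hy]
    | ht i j e a v => by_cases h : p j <;> simp [degreeProj_tmul, h]
  comm_d {m n} e (x : TensorX A g m) := by
    change degreeProj A g p n (tensorD A g e x) = tensorD A g e (degreeProj A g p m x)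
    induction x using tmul_induction with
    | h0 => simp
    | hadd x y hx hy => simp only [map_add, hx, hy]
    | ht i j e' a v =>
      -- With zero differential on `g`, the differential of `A ⊗ g` acts on `A` alone and keeps the
      -- degree in `g`.
      have key : tensorD A g e (tmul e' a v) =
          tmul (by omega) (A.d (sub_add_cancel i 1) a) v := by
        rw [tensorD_tmul e e' (sub_add_cancel i 1) (sub_add_cancel j 1), hd, tmul_zero_right,
          smul_zero, add_zero]
      rw [key, degreeProj_tmul, degreeProj_tmul]
      split_ifs
      · rw [key]
      · rw [map_zero]
  br_mem {m n k} e (x : TensorX A g m) (y : TensorX A g n) := by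
    change degreeProj A g p k (tensorBr A g e x y) = tensorBr A g e x y
    induction x using tmul_induction with
    | h0 => simp
    | hadd x y hx hy => simp only [map_add, LinearMap.add_apply, hx, hy]
    | ht i j e' a v =>
      induction y using tmul_induction with
      | h0 => simp
      | hadd x y hx hy => simp only [map_add, hx, hy]
      | ht i' j' e'' b w =>
        rw [tensorBr_tmul e e' e'' rfl rfl, map_smul, degreeProj_tmul]
        split_ifs with h
        · rfl
        · rw [(hbr rfl v w).resolve_left h, tmul_zero_right]
  central {m n k} e (x : TensorX A g m) (y : TensorX A g n) := by
    change tensorBr A g e (degreeProj A g p m x) y = 0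
    induction x using tmul_induction with
    | h0 => simp
    | hadd x y hx hy => simp only [map_add, LinearMap.add_apply, hx, hy, add_zero]
    | ht i j e' a v =>
      induction y using tmul_induction with
      | h0 => simp
      | hadd x y hx hy => simp only [map_add, hx, hy, add_zero]
      | ht i' j' e'' b w =>
        rw [degreeProj_tmul]
        split_ifs with h
        · rw [tensorBr_tmul e e' e'' rfl rfl, hc rfl v w h, tmul_zero_right, smul_zero]
        · simp

end CDGA

/-! ### The free graded Lie algebra on one generator -/

/-- The generator of the free graded Lie algebra on `ℚ[r]`, in the tensor algebra. -/
def lineGen (r : ℤ) : TensorAlgebra ℚ (⨁ i, shiftedLine r i) :=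
  TensorAlgebra.ι ℚ (DirectSum.lof ℚ ℤ (fun i => shiftedLine r i) r ⟨1, by simp [shiftedLine]⟩)

theorem koszul_of_even {n : ℤ} (h : Even n) : koszul n = 1 := by
  rw [← koszul_zero]
  exact koszul_congr (by simpa using h)

/-- The commutator of two powers of the generator `x` vanishes unless its Koszul sign is `-1`. Among
words in `x` and `x²` this happens only for `[x, x]` with `r` odd, since any factor `x²` has even
degree `2r`. Hence no new words appear beyond length two. -/
theorem isLieWord_line {r n : ℤ} {x : TensorAlgebra ℚ (⨁ i, shiftedLine r i)}
    (hx : IsLieWord (fun i => shiftedLine r i) n x) :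
    x = 0 ∨ (n = r ∧ ∃ c : ℚ, x = c • lineGen r) ∨
      (n = 2 * r ∧ Odd r ∧ ∃ c : ℚ, x = c • (lineGen r * lineGen r)) := by
  induction hx with
  | @of i v =>
    by_cases h : i = r
    · subst h
      refine .inr (.inl ⟨rfl, v.1, ?_⟩)
      rw [lineGen, ← map_smul, ← map_smul]
      congr 2
      exact Subtype.ext (by simp)
    · left
      have : v = 0 := Subtype.ext (by
        have := v.2
        simp only [shiftedLine, h, if_false, Submodule.mem_bot] at this
        exact this)
      rw [this, map_zero, map_zero]
  | @br i j x y _ _ ihx ihy =>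
    rcases ihx with rfl | ⟨rfl, c, rfl⟩ | ⟨rfl, hr, c, rfl⟩
    · simp
    · rcases ihy with rfl | ⟨rfl, c', rfl⟩ | ⟨rfl, hr, c', rfl⟩
      · simp
      -- The bracket of two multiples of the generator, now of degree `j`: zero for even degree, a
      -- multiple of the square for odd degree.
      · rcases Int.even_or_odd j with h | h
        · left
          rw [koszul_of_even (h.mul_left j)]
          simp [smul_smul, mul_comm]
        · refine .inr (.inr ⟨by ring, h, c * c' - koszul (j * j) * (c' * c), ?_⟩)
          simp only [mul_smul_comm, smul_mul_assoc, smul_smul]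
          module
      · left
        rw [koszul_of_even ⟨i * i, by ring⟩]
        simp [smul_smul, mul_comm, mul_assoc]
    · left
      rcases ihy with rfl | ⟨rfl, c', rfl⟩ | ⟨rfl, -, c', rfl⟩
      · simp
      · rw [koszul_of_even ⟨j * j, by ring⟩]
        simp [smul_smul, mul_comm, mul_assoc]
      · rw [koszul_of_even ⟨2 * r * r, by ring⟩]
        simp [smul_smul, mul_comm]

theorem freeLieX_line {r n : ℤ} {x : TensorAlgebra ℚ (⨁ i, shiftedLine r i)}
    (hx : x ∈ freeLieX (fun i => shiftedLine r i) n) (hn : n ≠ r) (hn' : Even r ∨ n ≠ 2 * r) :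
    x = 0 := by
  induction hx using Submodule.span_induction with
  | mem x hx =>
    rcases isLieWord_line hx with h | ⟨h, -⟩ | ⟨h, h', -⟩
    · exact h
    · exact absurd h hn
    · exact absurd h (hn'.resolve_left (Int.not_even_iff_odd.2 h'))
  | zero => rfl
  | add x y _ _ hx hy => rw [hx, hy, add_zero]
  | smul c x _ hx => rw [hx, smul_zero]

/-- No restriction is placed on `n`: in a degree other than `r` the scalar is simply zero. This
permits a uniform computation of brackets. -/
theorem freeLieX_line_even {r n : ℤ} (hr : Even r) {x : TensorAlgebra ℚ (⨁ i, shiftedLine r i)}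
    (hx : x ∈ freeLieX (fun i => shiftedLine r i) n) : ∃ c : ℚ, x = c • lineGen r := by
  induction hx using Submodule.span_induction with
  | mem x hx =>
    rcases isLieWord_line hx with h | ⟨-, h⟩ | ⟨-, h', -⟩
    · exact ⟨0, by simpa using h⟩
    · exact h
    · exact absurd hr (Int.not_even_iff_odd.2 h')
  | zero => exact ⟨0, by simp⟩
  | add x y _ _ hx hy =>
    obtain ⟨⟨c, rfl⟩, c', rfl⟩ := hx, hy
    exact ⟨c + c', (add_smul _ _ _).symm⟩
  | smul c x _ hx =>
    obtain ⟨c', rfl⟩ := hx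
    exact ⟨c * c', smul_smul _ _ _⟩

theorem freeLieLine_eq_zero {r n : ℤ} (x : (freeLieLine r).X n) (hn : n ≠ r)
    (hn' : Even r ∨ n ≠ 2 * r) : x = 0 :=
  Subtype.ext (freeLieX_line x.2 hn hn')

theorem freeLieLine_br_even {r : ℤ} (hr : Even r) {i j k : ℤ} (e : i + j = k)
    (x : (freeLieLine r).X i) (y : (freeLieLine r).X j) : (freeLieLine r).br e x y = 0 := by
  by_cases hi : i = r
  · subst hi
    obtain ⟨c, hc⟩ := freeLieX_line_even hr x.2
    obtain ⟨c', hc'⟩ := freeLieX_line_even hr y.2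
    refine Subtype.ext ?_
    change x.1 * y.1 - koszul (i * j) • (y.1 * x.1) = 0
    -- As `i` is even the sign is `+1` for every `j`, and two multiples of the same element commute.
    rw [koszul_of_even (hr.mul_right j), hc, hc']
    simp [smul_smul, mul_comm]
  · rw [freeLieLine_eq_zero x hi (.inl hr), map_zero, LinearMap.zero_apply]

theorem freeLieLine_br_mem_degree {r i j k : ℤ} (e : i + j = k) (x : (freeLieLine r).X i)
    (y : (freeLieLine r).X j) : k = 2 * r ∨ (freeLieLine r).br e x y = 0 := by
  rcases Int.even_or_odd r with hr | hr
  · exact .inr (freeLieLine_br_even hr e x y)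
  · rw [or_iff_not_imp_left]
    intro hk
    -- For odd `r` only `k = r` needs an argument, since other degrees apart from `2r` are zero.
    -- With `i = r` or `i = 2r` it would force `j = 0` or `j = -r`; as `r ≠ 0`, both are degrees
    -- where the algebra vanishes.
    by_cases hk' : k = r
    · by_cases hi : i = r
      · rw [freeLieLine_eq_zero y (by rintro rfl; obtain ⟨m, hm⟩ := hr; omega)
          (.inr (by rintro rfl; obtain ⟨m, hm⟩ := hr; omega)), map_zero]
      · by_cases hi' : i = 2 * r
        · rw [freeLieLine_eq_zero y (by obtain ⟨m, hm⟩ := hr; omega)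
            (.inr (by obtain ⟨m, hm⟩ := hr; omega)), map_zero]
        · rw [freeLieLine_eq_zero x hi (.inr hi'), map_zero, LinearMap.zero_apply]
    · exact freeLieLine_eq_zero _ hk' (.inr hk)

theorem freeLieLine_central {r i j k : ℤ} (e : i + j = k) (x : (freeLieLine r).X i)
    (y : (freeLieLine r).X j) (hi : i = 2 * r) : (freeLieLine r).br e x y = 0 := by
  rcases Int.even_or_odd r with hr | hr
  · exact freeLieLine_br_even hr e x y
  · by_cases hj : j = r ∨ j = 2 * r
    -- The bracket sits in degree `3r` or `4r`, and oddness gives `r ≠ 0`, so neither equals `r` or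
    -- `2r`.
    · exact freeLieLine_eq_zero _ (by obtain ⟨m, hm⟩ := hr; omega)
        (.inr (by obtain ⟨m, hm⟩ := hr; omega))
    · rw [not_or] at hj
      rw [freeLieLine_eq_zero y hj.1 (.inr hj.2), map_zero]

/-! ### Formality of the equivariant mapping Lie algebra. -/

/-- The central projection of `A ⊗ L(ℚ[r])` onto the part of bracket length two. -/
def CDGA.lineCentralProjection (A : CDGA.{u}) (r : ℤ) :
    DGLie.CentralProjection (CDGA.tensorLie A (freeLieLine r)) :=
  -- For even `r` this projection is zero if `r ≠ 0` and the identity if `r = 0`, where `r` and `2r`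
  -- coincide. Either is admissible, because all brackets then vanish.
  CDGA.centralProjection A (freeLieLine r) (fun q => q = 2 * r) (fun _ _ => rfl)
    freeLieLine_br_mem_degree freeLieLine_central

/-- The projection is restricted to the invariants first, and representatives and retraction are
chosen there. So these choices need not be equivariant, and no averaging over the group is required.
-/
theorem CDGA.isFormal_invariants_tensorLie_line {G : Type w} (A : CDGA.{u}) (r : ℤ)
    (φ : G → A.Hom A) (ψ : G → (freeLieLine r).Hom (freeLieLine r)) :
    DGLie.IsFormal ((CDGA.tensorLie A (freeLieLine r)).invariants
      fun a => CDGA.tensorLieMap (φ a) (ψ a)) :=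
  ((A.lineCentralProjection r).invariants (fun a => CDGA.tensorLieMap (φ a) (ψ a))
    fun a i x => CDGA.degreeProj_tensorMapX (fun q => q = 2 * r) (φ a) (ψ a) i x).isFormal

theorem equivariantMapLie_isFormal (n : ℕ) (M : Type u) [TopologicalSpace M]
    [ChartedSpace (EuclideanSpace ℝ (Fin n)) M] [IsManifold (𝓡 n) ∞ M]
    (K : Representation ℚ ℤˣ ℚ) (r : ℤ) : DGLie.IsFormal (equivariantMapLie n M K r) :=
  CDGA.isFormal_invariants_tensorLie_line
    (reducedAPL (OnePoint (OrientationCover n M)) OnePoint.infty) r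
    (fun ε => reducedAPLMap (deckPlus n M ε⁻¹) _ _ rfl)
    (fun ε => freeLieMap (shiftedLineMap r (K ε)))

end

theorem mainTheorem9 (n : ℕ) (M : Type u) [TopologicalSpace M] [T2Space M]
    [SecondCountableTopology M] [ChartedSpace (EuclideanSpace ℝ (Fin n)) M]
    [IsManifold (𝓡 n) ∞ M] (K : Representation ℚ ℤˣ ℚ)
    (hK : K = Representation.trivial ℚ ℤˣ ℚ ∨ K = signRep) (r : ℤ) (g : DGLie.{u})
    (hg : DGLie.Equivalent g (equivariantMapLie n M K r)) :
    DGLie.IsFormal g :=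
  (equivariantMapLie_isFormal n M K r).of_equivalent hg
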